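/- Let $\mu$ be Lebesgue measure on $[0,1]$ and $L_1[0,1]$ the real $L_1$-space. Let $T=\bigcup_{n\ge 1}\{0,1\}^n$ be the set of non-empty finite $0$-$1$ sequences, and write $|t|=n$ for $t\in\{0,1\}^n$. For an interval $A=[a,b)$ put $A^{\emptyset}=A$ and, if $A^{t}=[c,d)$, put $A^{t^\frown(0)}=[c,\frac{c+d}{2})$ and $A^{t^\frown(1)}=[\frac{c+d}{2},d)$. For $n\ge 1$ let $B_n=[2^{-n-1},2^{-n})$ and $C_n=\frac12+B_n$; this defines $B_n^t$ and $C_n^t$ for $t\in T$. For $t\in T$ define in $L_1[0,1]$ $$f_t=2^{|t|+1}\Bigl(\mathbf 1_{C_{|t|}^t}+\sum_{i=1}^{|t|}\mathbf 1_{B_i^t}\Bigr),\qquad h_t=2^{|t|+1}\sum_{i=1}^{\infty}\mathbf 1_{B_i^t},$$ and let $X=\overline{\mathrm{span}}\{f_t:t\in T\}$, $Y=\overline{\mathrm{span}}\{h_t:t\in T\}$. For a real Banach space $E$ with closed unit ball $B_E$ and unit sphere $S_E$, a slice of $B_E$ is a set $S(\varphi,\alpha)=\{x\in B_E:\varphi(x)>\sup\varphi(B_E)-\alpha\}$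 with $\varphi\in E^*$, $\alpha>0$. A point $x\in S_E$ is a $\Delta$-point if $\sup_{y\in S}\|x-y\|=2$ for every slice $S$ of $B_E$ containing $x$; a super $\Delta$-point if $\sup_{y\in W}\|x-y\|=2$ for every relatively weakly open subset $W$ of $B_E$ containing $x$; and a relative Daugavet-point if there are $\varphi\in S_{E^*}$ with $\varphi(x)=1$ and $\alpha>0$ such that $\sup_{y\in R}\|x-y\|=2$ for every slice $R$ of $B_E$ contained in $S(\varphi,\alpha)$. The space $E$ has the diametral local diameter 2 property (DLD2P) if every $x\in S_E$ is a $\Delta$-point. Theorem. $X$ is a non-reflexive subspace of $L_1[0,1]$ without the DLD2P, and $Y$ is a subspace of $X$ that is isometrically isomorphic to $L_1[0,1]$. Every $y\in S_Y$ is a $\Delta$-point, and even a super $\Delta$-point, both in $Y$ and in $X$, but no $y\in S_Y$ is a relative Daugavet-point in $X$. -/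

import Mathlib

namespace DaugavetL1

open MeasureTheory Set

noncomputable section

/-! ### Slices and diametral points in a real normed space -/

section Points

variable {E : Type*} [NormedAddCommGroup E] [NormedSpace ℝ E]

/-- The slice `S(φ, α) = {x ∈ B_E : φ x > sup φ(B_E) - α}` of the closed unit ball. -/
def slice (φ : StrongDual ℝ E) (α : ℝ) : Set E :=
  {x | x ∈ Metric.closedBall (0 : E) 1 ∧ sSup (φ '' Metric.closedBall (0 : E) 1) - α < φ x}

/-- `sup_{y ∈ S} ‖x - y‖ = 2`. -/
def SupDistEqTwo (x : E) (S : Set E) : Prop :=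
  IsLUB ((fun y => ‖x - y‖) '' S) 2

/-- Relatively weakly open subsets of the closed unit ball. -/
def IsRelWeaklyOpenInBall (W : Set E) : Prop :=
  ∃ V : Set (WeakSpace ℝ E), IsOpen V ∧
    W = Metric.closedBall (0 : E) 1 ∩ (toWeakSpace ℝ E) ⁻¹' V

/-- `x ∈ S_E` is a `Δ`-point: `sup_{y ∈ S} ‖x - y‖ = 2` for every slice `S` of `B_E`
containing `x`. -/
def IsDeltaPoint (x : E) : Prop :=
  ‖x‖ = 1 ∧ ∀ (φ : StrongDual ℝ E) (α : ℝ), 0 < α → x ∈ slice φ α →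
    SupDistEqTwo x (slice φ α)

/-- `x ∈ S_E` is a super `Δ`-point: `sup_{y ∈ W} ‖x - y‖ = 2` for every relatively weakly open
subset `W` of `B_E` containing `x`. -/
def IsSuperDeltaPoint (x : E) : Prop :=
  ‖x‖ = 1 ∧ ∀ W : Set E, IsRelWeaklyOpenInBall W → x ∈ W → SupDistEqTwo x W

/-- `x ∈ S_E` is a relative Daugavet-point: there are a norm-one functional `φ` with `φ x = 1`
and `α > 0` such that `sup_{y ∈ T} ‖x - y‖ = 2` for every slice `T` of `B_E` contained in the
slice `S(φ, α)`. -/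
def IsRelativeDaugavetPoint (x : E) : Prop :=
  ‖x‖ = 1 ∧ ∃ (φ : StrongDual ℝ E) (α : ℝ), ‖φ‖ = 1 ∧ φ x = 1 ∧ 0 < α ∧
    ∀ (ψ : StrongDual ℝ E) (β : ℝ), 0 < β → slice ψ β ⊆ slice φ α →
      SupDistEqTwo x (slice ψ β)

end Points

/-- The diametral local diameter 2 property: every point of the unit sphere is a `Δ`-point. -/
def HasDLD2P (E : Type*) [NormedAddCommGroup E] [NormedSpace ℝ E] : Prop :=
  ∀ x : E, ‖x‖ = 1 → IsDeltaPoint x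

/-- Reflexivity: the canonical embedding into the bidual is onto. -/
def IsReflexiveSpace (E : Type*) [NormedAddCommGroup E] [NormedSpace ℝ E] : Prop :=
  Function.Surjective (NormedSpace.inclusionInDoubleDual ℝ E)

/-! ### The dyadic systems -/

/-- The real Banach space `L_1[0,1]`. -/
abbrev L1I : Type := Lp ℝ 1 (volume.restrict (Icc (0 : ℝ) 1))

/-- Left (`false`, i.e. `0`) or right (`true`, i.e. `1`) half of an interval `[a, b)`, given by
its pair of end points. -/
def half (I : ℝ × ℝ) (e : Bool) : ℝ × ℝ :=
  if e then ((I.1 + I.2) / 2, I.2) else (I.1, (I.1 + I.2) / 2)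

/-- The interval `A^t` obtained from `A = [a, b)` by halving along `t = (t_1, ..., t_n)`,
first according to `t_1`, then according to `t_2`, and so on. -/
def subInterval (I : ℝ × ℝ) (t : List Bool) : Set ℝ :=
  Ico (t.foldl half I).1 (t.foldl half I).2

/-- `B_n^t`, where `B_n = [2^{-(n+1)}, 2^{-n})`. -/
def setB (n : ℕ) (t : List Bool) : Set ℝ :=
  subInterval (1 / 2 ^ (n + 1), 1 / 2 ^ n) t

/-- `C_n^t`, where `C_n = 1/2 + B_n`. -/
def setC (n : ℕ) (t : List Bool) : Set ℝ :=
  subInterval (1 / 2 + 1 / 2 ^ (n + 1), 1 / 2 + 1 / 2 ^ n) t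

/-- `f_t = 2^{|t|+1} (1_{C_{|t|}^t} + ∑_{i=1}^{|t|} 1_{B_i^t})` as a function. -/
def fFun (t : List Bool) (x : ℝ) : ℝ :=
  2 ^ (t.length + 1) * ((setC t.length t).indicator 1 x
    + ∑ i ∈ Finset.Icc 1 t.length, (setB i t).indicator 1 x)

/-- `h_t = 2^{|t|+1} ∑_{i=1}^∞ 1_{B_i^t}` as a function (at every point at most one term of the
series is non-zero). -/
def hFun (t : List Bool) (x : ℝ) : ℝ :=
  2 ^ (t.length + 1) * ∑' i : ℕ, (setB (i + 1) t).indicator 1 x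

theorem measurableSet_subInterval (I : ℝ × ℝ) (t : List Bool) :
    MeasurableSet (subInterval I t) := measurableSet_Ico

theorem foldl_half_mem (t : List Bool) : ∀ I : ℝ × ℝ, I.1 ≤ I.2 →
    I.1 ≤ (t.foldl half I).1 ∧ (t.foldl half I).2 ≤ I.2 := by
  induction t with
  | nil => intro I _; exact ⟨le_rfl, le_rfl⟩
  | cons e t ih =>
    intro I hI
    have key : I.1 ≤ (half I e).1 ∧ (half I e).1 ≤ (half I e).2 ∧ (half I e).2 ≤ I.2 := by
      cases e <;> simp only [half] <;> refine ⟨?_, ?_, ?_⟩ <;> simp <;> linarith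
    obtain ⟨h1, h2⟩ := ih (half I e) key.2.1
    exact ⟨key.1.trans h1, h2.trans key.2.2⟩

theorem setB_subset (n : ℕ) (t : List Bool) :
    setB n t ⊆ Ico (1 / 2 ^ (n + 1) : ℝ) (1 / 2 ^ n) := by
  have h := foldl_half_mem t (1 / 2 ^ (n + 1), 1 / 2 ^ n)
    (one_div_le_one_div_of_le (by positivity) (pow_le_pow_right₀ (by norm_num) (Nat.le_succ n)))
  exact Ico_subset_Ico h.1 h.2

theorem setB_index_unique {m n : ℕ} {t : List Bool} {x : ℝ} (hm : x ∈ setB m t)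
    (hn : x ∈ setB n t) : m = n := by
  have aux : ∀ {a b : ℕ}, x ∈ setB a t → x ∈ setB b t → ¬ a < b := by
    intro a b ha hb hab
    have h1 := (setB_subset a t ha).1
    have h2 := (setB_subset b t hb).2
    have h3 : (1 / 2 ^ b : ℝ) ≤ 1 / 2 ^ (a + 1) :=
      one_div_le_one_div_of_le (by positivity) (pow_le_pow_right₀ (by norm_num) hab)
    linarith
  have := aux hm hn
  have := aux hn hm
  omega

theorem hFun_eq (t : List Bool) :
    hFun t = fun x => 2 ^ (t.length + 1) * (⋃ i : ℕ, setB (i + 1) t).indicator 1 x := by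
  funext x
  unfold hFun
  congr 1
  by_cases hx : x ∈ ⋃ i : ℕ, setB (i + 1) t
  · obtain ⟨k, hk⟩ := mem_iUnion.1 hx
    rw [indicator_of_mem hx, tsum_eq_single k, indicator_of_mem hk]
    intro j hj
    refine indicator_of_notMem (fun hj' => hj ?_) _
    have := setB_index_unique hj' hk
    omega
  · rw [indicator_of_notMem hx]
    have : ∀ i : ℕ, (setB (i + 1) t).indicator (1 : ℝ → ℝ) x = 0 := fun i =>
      indicator_of_notMem (fun hi => hx (mem_iUnion.2 ⟨i, hi⟩)) _
    simp [this]

theorem memLp_indicator_one {s : Set ℝ} (hs : MeasurableSet s) :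
    MemLp (fun x => s.indicator (1 : ℝ → ℝ) x) 1 (volume.restrict (Icc (0 : ℝ) 1)) :=
  (memLp_const (1 : ℝ)).indicator hs

theorem memLp_fFun (t : List Bool) : MemLp (fFun t) 1 (volume.restrict (Icc (0 : ℝ) 1)) := by
  have h1 := memLp_indicator_one (s := setC t.length t) (measurableSet_subInterval _ _)
  have h2 : ∀ i, MemLp (fun x => (setB i t).indicator (1 : ℝ → ℝ) x) 1
      (volume.restrict (Icc (0 : ℝ) 1)) :=
    fun i => memLp_indicator_one (measurableSet_subInterval _ _)
  have h3 := memLp_finsetSum (Finset.Icc 1 t.length) fun i _ => h2 i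
  exact (h1.add h3).const_mul _

theorem memLp_hFun (t : List Bool) : MemLp (hFun t) 1 (volume.restrict (Icc (0 : ℝ) 1)) := by
  have h1 := memLp_indicator_one (s := ⋃ i : ℕ, setB (i + 1) t)
    (MeasurableSet.iUnion fun i => measurableSet_subInterval _ _)
  rw [hFun_eq]
  exact h1.const_mul _

/-- `f_t` as an element of `L_1[0,1]`. -/
def f (t : List Bool) : L1I := (memLp_fFun t).toLp (fFun t)

/-- `h_t` as an element of `L_1[0,1]`. -/
def h (t : List Bool) : L1I := (memLp_hFun t).toLp (hFun t)

/-- The tree `T = ⋃_{n ≥ 1} {0,1}^n` of non-empty finite `0`-`1` sequences. -/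
def tree : Set (List Bool) := {t | t ≠ []}

/-- `X`, the closed linear span of `(f_t)_{t ∈ T}`. -/
def spaceX : Submodule ℝ L1I := (Submodule.span ℝ (f '' tree)).topologicalClosure

/-- `Y`, the closed linear span of `(h_t)_{t ∈ T}`. -/
def spaceY : Submodule ℝ L1I := (Submodule.span ℝ (h '' tree)).topologicalClosure

end

end DaugavetL1

namespace DaugavetL1

open MeasureTheory Set Filter Topology
open scoped ENNReal

noncomputable section

/-! ### Dyadic trees in a normed space -/

/-! Call a family indexed by finite 0-1 sequences a dyadic ℓ₁-tree if every vector is the average of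
its two successors and every level spans a finite-dimensional ℓ₁ isometrically. Such a tree
determines its closed span up to isometry (`nonempty_linearIsometryEquiv`). The `h t` and the
normalised indicators of the dyadic subintervals of [0,1) are both of this kind, so Y is a copy of
L₁. The mean of the `f s` over the extensions s of t of length k is the normalised indicator of
`setF k t`. It converges to `h t`, and this places Y inside X.

Super Δ-points: along the tree a functional φ is a bounded martingale, so its jumps between levels
tend to 0 in mean. Doubling a density on one half of each set of a deep level and erasing it on the
other half keeps the norm and is a weakly small change (`IsTree.tendsto_doubleAt`). After m such
doublings the distance to the original vector is at least 2 - 2·2^{-m} (`IsTree.isSuperDeltaPoint`).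
An isometric inclusion is weakly continuous, so the property passes from Y to X. X is not reflexive
because the mass of `h t` along a branch escapes to null sets.

Negative statements: functions g in the span of the `fFun t` satisfy g(x) = g(x+1/2) + g(x/2) on
every B_i and are constant on C_{|t|}^t. Hence on the support of f_t such a g differs from a
constant by at most a multiple of its mass off that support. So integration over the support
strongly exposes f_t in X (`exists_norm_sub_setInt_smul_f_le`), and ±f_t have slices of arbitrarily
small diameter (`exists_slice_subset`). Therefore f_t is not a Δ-point. A norm-one x in Y is a limit
of combinations of the f_s with coefficients the integrals of x over their supports. If φ(x) = 1,
some ±f_s lies in the given slice of φ with x having mass of the same sign on supp f_s. Then ‖x ∓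
f_s‖ < 2, and a small slice around ±f_s refutes the relative Daugavet property. -/

/-- The `0`-`1` sequences of length `n`. -/
def level : ℕ → Finset (List Bool)
  | 0 => {[]}
  | n + 1 => (level n).biUnion fun t => {t ++ [false], t ++ [true]}

theorem mem_level {n : ℕ} {t : List Bool} : t ∈ level n ↔ t.length = n := by
  induction n generalizing t with
  | zero => simp [level]
  | succ n ih =>
    simp only [level, Finset.mem_biUnion, ih, Finset.mem_insert, Finset.mem_singleton]
    constructor
    · rintro ⟨s, hs, rfl | rfl⟩ <;> simp [hs]
    · intro ht
      have hne : t ≠ [] := by rintro rfl; simp at ht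
      refine ⟨t.dropLast, by simp [ht], ?_⟩
      have := List.dropLast_append_getLast hne
      cases hb : t.getLast hne
      · left; rw [← hb, this]
      · right; rw [← hb, this]

theorem sum_level_succ {M : Type*} [AddCommMonoid M] (n : ℕ) (g : List Bool → M) :
    ∑ t ∈ level (n + 1), g t = ∑ t ∈ level n, (g (t ++ [false]) + g (t ++ [true])) := by
  rw [level, Finset.sum_biUnion]
  · refine Finset.sum_congr rfl fun t _ => Finset.sum_pair ?_
    simp
  · intro s _ t _ hst
    simp only [Function.onFun, Finset.disjoint_left, Finset.mem_insert, Finset.mem_singleton]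
    rintro x (rfl | rfl) (h | h)
    all_goals simp_all

theorem card_level (n : ℕ) : (level n).card = 2 ^ n := by
  have : ∀ n, ∑ t ∈ level n, (1 : ℕ) = 2 ^ n := by
    intro n
    induction n with
    | zero => simp [level]
    | succ n ih => rw [sum_level_succ, Finset.sum_add_distrib, ih]; ring
  simpa using this n

/-- `u t` depends on the first `n` entries of `t` only, when `t` has at least `n` entries. -/
def DeterminedAt (n : ℕ) (u : List Bool → ℝ) : Prop :=
  ∀ t b, n ≤ t.length → u (t ++ [b]) = u t

theorem DeterminedAt.mono {m n : ℕ} {u : List Bool → ℝ} (hu : DeterminedAt m u) (hmn : m ≤ n) :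
    DeterminedAt n u := fun t b ht => hu t b (hmn.trans ht)

section Normed

variable {E : Type*} [NormedAddCommGroup E] [NormedSpace ℝ E]

/-- Every vector of the family is the average of its two successors. -/
def IsTree (e : List Bool → E) : Prop :=
  ∀ t, e t = (1 / 2 : ℝ) • (e (t ++ [false]) + e (t ++ [true]))

/-- Each level of the tree is isometrically the unit vector basis of a finite dimensional `ℓ₁`. -/
def IsL1Tree (e : List Bool → E) : Prop :=
  ∀ (n : ℕ) (a : List Bool → ℝ), ‖∑ t ∈ level n, a t • e t‖ = ∑ t ∈ level n, |a t|

/-- The vector with density `u` on level `n` of the tree `e`. -/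
def vec (e : List Bool → E) (n : ℕ) (u : List Bool → ℝ) : E :=
  ∑ t ∈ level n, ((1 / 2) ^ n * u t) • e t

/-- The average of `|u|` over level `n`. -/
def avgAbs (n : ℕ) (u : List Bool → ℝ) : ℝ :=
  ∑ t ∈ level n, (1 / 2) ^ n * |u t|

theorem IsL1Tree.norm_vec {e : List Bool → E} (he : IsL1Tree e) (n : ℕ) (u : List Bool → ℝ) :
    ‖vec e n u‖ = avgAbs n u := by
  rw [vec, he, avgAbs]
  refine Finset.sum_congr rfl fun t _ => ?_
  rw [abs_mul, abs_of_nonneg (by positivity)]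

theorem IsL1Tree.norm_eq_one {e : List Bool → E} (he : IsL1Tree e) (t : List Bool) :
    ‖e t‖ = 1 := by
  have h := he t.length fun s => if s = t then 1 else 0
  have ht : t ∈ level t.length := mem_level.2 rfl
  rw [Finset.sum_eq_single t (fun s _ hs => by simp [hs]) (fun h => absurd ht h),
    Finset.sum_eq_single t (fun s _ hs => by simp [hs]) (fun h => absurd ht h)] at h
  simpa using h

theorem IsTree.vec_succ {e : List Bool → E} (he : IsTree e) {n : ℕ} {u : List Bool → ℝ}
    (hu : DeterminedAt n u) : vec e (n + 1) u = vec e n u := by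
  rw [vec, sum_level_succ, vec]
  refine Finset.sum_congr rfl fun t ht => ?_
  rw [hu t _ (mem_level.1 ht).ge, hu t _ (mem_level.1 ht).ge, ← smul_add, he t, smul_smul]
  congr 1
  ring

theorem IsTree.vec_eq {e : List Bool → E} (he : IsTree e) {m n : ℕ} {u : List Bool → ℝ}
    (hu : DeterminedAt m u) (hmn : m ≤ n) : vec e n u = vec e m u := by
  induction n, hmn using Nat.le_induction with
  | base => rfl
  | succ n hmn ih => rw [he.vec_succ (hu.mono hmn), ih]

theorem avgAbs_succ {n : ℕ} {u : List Bool → ℝ} (hu : DeterminedAt n u) :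
    avgAbs (n + 1) u = avgAbs n u := by
  rw [avgAbs, sum_level_succ, avgAbs]
  refine Finset.sum_congr rfl fun t ht => ?_
  rw [hu t _ (mem_level.1 ht).ge, hu t _ (mem_level.1 ht).ge]
  ring

theorem avgAbs_eq {m n : ℕ} {u : List Bool → ℝ} (hu : DeterminedAt m u) (hmn : m ≤ n) :
    avgAbs n u = avgAbs m u := by
  induction n, hmn using Nat.le_induction with
  | base => rfl
  | succ n hmn ih => rw [avgAbs_succ (hu.mono hmn), ih]

/-- The averaging relation pushes any finite combination down to a single common level. -/
theorem IsTree.exists_vec {e : List Bool → E} (he : IsTree e) {x : E}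
    (hx : x ∈ Submodule.span ℝ (range e)) : ∃ n u, DeterminedAt n u ∧ vec e n u = x := by
  induction hx using Submodule.span_induction with
  | mem x hx =>
    obtain ⟨t, rfl⟩ := hx
    -- The value 2^{|t|} cancels the weight 2^{-|t|} in `vec`; testing only a prefix makes the
    -- density inherited by extensions.
    refine ⟨t.length, fun s => if s.take t.length = t then 2 ^ t.length else 0, ?_, ?_⟩
    · intro s b hs
      simp only [List.take_append_of_le_length hs]
    · rw [vec, Finset.sum_eq_single t]
      · simp
      · intro s hs hst
        rw [List.take_of_length_le (mem_level.1 hs).le]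
        simp [hst]
      · exact fun h => absurd (mem_level.2 rfl) h
  | zero => exact ⟨0, 0, fun _ _ _ => rfl, by simp [vec]⟩
  | add x y _ _ hx hy =>
    obtain ⟨m, u, hu, rfl⟩ := hx
    obtain ⟨n, v, hv, rfl⟩ := hy
    refine ⟨max m n, u + v, ?_, ?_⟩
    · intro t b ht
      simp [hu t b (le_of_max_le_left ht), hv t b (le_of_max_le_right ht)]
    · rw [← he.vec_eq hu (le_max_left m n), ← he.vec_eq hv (le_max_right m n)]
      simp only [vec, Pi.add_apply, mul_add, add_smul, Finset.sum_add_distrib]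
  | smul c x _ hx =>
    obtain ⟨m, u, hu, rfl⟩ := hx
    refine ⟨m, c • u, ?_, ?_⟩
    · intro t b ht
      simp [hu t b ht]
    · simp only [vec, Pi.smul_apply, Finset.smul_sum, smul_smul, smul_eq_mul]
      refine Finset.sum_congr rfl fun t _ => ?_
      congr 1
      ring

end Normed

section Isometry

variable {E F : Type*} [NormedAddCommGroup E] [NormedSpace ℝ E]
  [NormedAddCommGroup F] [NormedSpace ℝ F]

/-- Applying `IsTree.exists_vec` to the pair tree gives the same level and density for both trees at
once, hence equal norms. -/
theorem IsTree.prodMk {e : List Bool → E} {e' : List Bool → F} (he : IsTree e)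
    (he' : IsTree e') : IsTree fun t => (e t, e' t) := fun t => by
  simp only [Prod.mk_add_mk, Prod.smul_mk]
  rw [← he t, ← he' t]

theorem norm_linearCombination_eq {e : List Bool → E} {e' : List Bool → F} (he : IsTree e)
    (he' : IsTree e') (h1 : IsL1Tree e) (h1' : IsL1Tree e') (c : List Bool →₀ ℝ) :
    ‖Finsupp.linearCombination ℝ e c‖ = ‖Finsupp.linearCombination ℝ e' c‖ := by
  have hmem : Finsupp.linearCombination ℝ (fun t => (e t, e' t)) c ∈
      Submodule.span ℝ (range fun t => (e t, e' t)) := by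
    rw [← Finsupp.range_linearCombination]
    exact LinearMap.mem_range_self _ _
  obtain ⟨n, u, -, hu⟩ := (he.prodMk he').exists_vec hmem
  have hfst : Finsupp.linearCombination ℝ e c = vec e n u := by
    have := congrArg Prod.fst hu
    simp only [vec, Prod.fst_sum, Prod.smul_fst, Finsupp.linearCombination_apply,
      Finsupp.sum] at this
    simp only [vec, Finsupp.linearCombination_apply, Finsupp.sum, this]
  have hsnd : Finsupp.linearCombination ℝ e' c = vec e' n u := by
    have := congrArg Prod.snd hu
    simp only [vec, Prod.snd_sum, Prod.smul_snd, Finsupp.linearCombination_apply,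
      Finsupp.sum] at this
    simp only [vec, Finsupp.linearCombination_apply, Finsupp.sum, this]
  rw [hfst, hsnd, h1.norm_vec, h1'.norm_vec]

theorem denseRange_linearCombination {e : List Bool → E}
    (hd : Dense (Submodule.span ℝ (range e) : Set E)) :
    DenseRange (Finsupp.linearCombination ℝ e) := by
  rw [← Finsupp.range_linearCombination] at hd
  exact hd

/-- Two Banach spaces densely spanned by dyadic `ℓ₁`-trees are isometrically isomorphic. -/
theorem nonempty_linearIsometryEquiv [CompleteSpace E] [CompleteSpace F]
    {e : List Bool → E} {e' : List Bool → F} (he : IsTree e)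
    (he' : IsTree e') (h1 : IsL1Tree e) (h1' : IsL1Tree e')
    (hd : Dense (Submodule.span ℝ (range e) : Set E))
    (hd' : Dense (Submodule.span ℝ (range e') : Set F)) : Nonempty (E ≃ₗᵢ[ℝ] F) :=
  ⟨(LinearEquiv.refl ℝ (List Bool →₀ ℝ)).extendOfIsometry (Finsupp.linearCombination ℝ e)
    (Finsupp.linearCombination ℝ e') (denseRange_linearCombination hd)
    (denseRange_linearCombination hd')
    fun c => (norm_linearCombination_eq he he' h1 h1' c).symm⟩

end Isometry

/-! ### Super `Δ`-points from trees -/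

section Super

variable {E : Type*} [NormedAddCommGroup E] [NormedSpace ℝ E]

theorem supDistEqTwo_of_forall {E : Type*} [NormedAddCommGroup E] {x : E} {S : Set E} (hx : ‖x‖ = 1)
    (hS : S ⊆ Metric.closedBall 0 1) (h : ∀ ε > 0, ∃ y ∈ S, 2 - ε ≤ ‖x - y‖) :
    SupDistEqTwo x S := by
  constructor
  · rintro _ ⟨y, hy, rfl⟩
    have hy1 : ‖y‖ ≤ 1 := by simpa using hS hy
    have := norm_sub_le x y
    show ‖x - y‖ ≤ 2
    linarith
  · intro b hb
    refine le_of_forall_pos_le_add fun ε hε => ?_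
    obtain ⟨y, hy, hxy⟩ := h ε hε
    have : ‖x - y‖ ≤ b := hb ⟨y, hy, rfl⟩
    linarith

theorem continuous_eval_weakSpace (φ : StrongDual ℝ E) :
    Continuous fun x : WeakSpace ℝ E => φ ((toWeakSpace ℝ E).symm x) :=
  WeakBilin.eval_continuous (topDualPairing ℝ E).flip φ

/-- Slices are relatively weakly open. -/
theorem IsSuperDeltaPoint.isDeltaPoint {x : E} (hx : IsSuperDeltaPoint x) : IsDeltaPoint x := by
  refine ⟨hx.1, fun φ α _ hxs => hx.2 _ ⟨{z | sSup (φ '' Metric.closedBall (0 : E) 1) - α <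
    φ ((toWeakSpace ℝ E).symm z)}, ?_, ?_⟩ hxs⟩
  · exact isOpen_lt continuous_const (continuous_eval_weakSpace φ)
  · ext z
    simp [slice]

/-- Linear isometries are weak-to-weak continuous, so weakly open sets pull back and distances are
kept. -/
theorem IsSuperDeltaPoint.map {F : Type*} [NormedAddCommGroup F] [NormedSpace ℝ F]
    (i : E →ₗᵢ[ℝ] F) {x : E} (hx : IsSuperDeltaPoint x) : IsSuperDeltaPoint (i x) := by
  refine ⟨by rw [i.norm_map, hx.1], ?_⟩
  rintro W ⟨V, hV, rfl⟩ hxW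
  have hV' : IsOpen (WeakSpace.map i.toContinuousLinearMap ⁻¹' V) :=
    hV.preimage (WeakSpace.map i.toContinuousLinearMap).continuous
  have key := hx.2 _ ⟨_, hV', rfl⟩ ⟨by simp [hx.1], hxW.2⟩
  refine supDistEqTwo_of_forall (by rw [i.norm_map, hx.1]) inter_subset_left fun ε hε => ?_
  obtain ⟨_, ⟨y, hy, rfl⟩, h1, -⟩ := key.exists_between (show (2 : ℝ) - ε < 2 by linarith)
  refine ⟨i y, ⟨?_, hy.2⟩, ?_⟩
  · have := hy.1
    simpa using this
  · rw [← map_sub, i.norm_map]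
    exact h1.le

theorem tendsto_toWeakSpace {ι : Type*} {l : Filter ι} {z : ι → E} {x : E}
    (h : ∀ φ : StrongDual ℝ E, Tendsto (fun i => φ (z i)) l (𝓝 (φ x))) :
    Tendsto (fun i => toWeakSpace ℝ E (z i)) l (𝓝 (toWeakSpace ℝ E x)) := by
  have hinj : Function.Injective (topDualPairing ℝ E).flip := by
    intro a b hab
    refine (SeparatingDual.eq_iff_forall_dual_eq (R := ℝ)).2 fun g => ?_
    exact congrArg (fun L => L g) hab
  exact (WeakBilin.tendsto_iff_forall_eval_tendsto _ hinj).2 h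

/-- The averaged oscillation of a functional between consecutive levels of a bounded tree tends
to zero. -/
theorem IsTree.tendsto_oscillation {e : List Bool → E} (he : IsTree e) (h1 : IsL1Tree e)
    (φ : StrongDual ℝ E) :
    Tendsto (fun n => ∑ t ∈ level n,
      (1 / 2 : ℝ) ^ n * |φ (e (t ++ [false])) - φ (e (t ++ [true]))|) atTop (𝓝 0) := by
  set d : List Bool → ℝ := fun t => φ (e (t ++ [false])) - φ (e (t ++ [true])) with hd
  -- Second moments of the martingale `φ (e t)`: they increase, are bounded by ‖φ‖², and their
  -- increments are a quarter of the mean squared jumps.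
  set q : ℕ → ℝ := fun n => ∑ t ∈ level n, (1 / 2 : ℝ) ^ n * φ (e t) ^ 2 with hq
  have hstep : ∀ n, ∑ t ∈ level n, (1 / 2 : ℝ) ^ n * d t ^ 2 = 4 * (q (n + 1) - q n) := by
    intro n
    simp only [hq]
    rw [sum_level_succ, ← Finset.sum_sub_distrib, Finset.mul_sum]
    refine Finset.sum_congr rfl fun t _ => ?_
    rw [he t]
    simp only [hd, map_smul, map_add, smul_eq_mul]
    ring
  have hmono : Monotone q := monotone_nat_of_le_succ fun n => by
    have : 0 ≤ ∑ t ∈ level n, (1 / 2 : ℝ) ^ n * d t ^ 2 :=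
      Finset.sum_nonneg fun t _ => by positivity
    rw [hstep] at this
    linarith
  have hbdd : BddAbove (range q) := by
    refine ⟨‖φ‖ ^ 2, ?_⟩
    rintro _ ⟨n, rfl⟩
    have : q n ≤ ∑ t ∈ level n, (1 / 2 : ℝ) ^ n * ‖φ‖ ^ 2 := by
      refine Finset.sum_le_sum fun t _ => ?_
      have : |φ (e t)| ≤ ‖φ‖ := by
        have := φ.le_opNorm (e t)
        rwa [h1.norm_eq_one, mul_one] at this
      have := sq_le_sq' (abs_le.1 this).1 (abs_le.1 this).2
      gcongr
    rw [Finset.sum_const, card_level, nsmul_eq_mul, ← mul_assoc, Nat.cast_pow, Nat.cast_ofNat,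
      ← mul_pow] at this
    norm_num at this
    exact this
  have hlim := tendsto_atTop_ciSup hmono hbdd
  have hdiff : Tendsto (fun n => ∑ t ∈ level n, (1 / 2 : ℝ) ^ n * d t ^ 2) atTop (𝓝 0) := by
    simp only [hstep]
    have := ((hlim.comp (tendsto_add_atTop_nat 1)).sub hlim).const_mul 4
    simpa using this
  have hsqrt := (Real.continuous_sqrt.tendsto 0).comp hdiff
  rw [Real.sqrt_zero] at hsqrt
  refine squeeze_zero (fun n => Finset.sum_nonneg fun t _ => by positivity) (fun n => ?_) hsqrt
  refine Real.le_sqrt_of_sq_le ?_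
  -- Cauchy–Schwarz against the constant 1 passes from the quadratic mean of the jumps to the mean
  -- of their absolute values.
  have hcs := Finset.sum_mul_sq_le_sq_mul_sq (level n) (fun _ => (1 : ℝ)) (fun t => |d t|)
  show _ ≤ ∑ t ∈ level n, (1 / 2 : ℝ) ^ n * d t ^ 2
  rw [← Finset.mul_sum, ← Finset.mul_sum, mul_pow]
  simp only [one_mul, one_pow, Finset.sum_const, card_level, nsmul_eq_mul, mul_one, sq_abs,
    Nat.cast_pow, Nat.cast_ofNat] at hcs
  calc ((1 / 2 : ℝ) ^ n) ^ 2 * (∑ t ∈ level n, |d t|) ^ 2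
      ≤ ((1 / 2 : ℝ) ^ n) ^ 2 * (2 ^ n * ∑ t ∈ level n, d t ^ 2) := by gcongr
    _ = (1 / 2 : ℝ) ^ n * ∑ t ∈ level n, d t ^ 2 := by
      have : (1 / 2 : ℝ) ^ n * 2 ^ n = 1 := by rw [← mul_pow]; norm_num
      linear_combination ((1 / 2 : ℝ) ^ n * ∑ t ∈ level n, d t ^ 2) * this

/-- Doubling a density on the sequences whose entry number `k` is `0`, and removing it elsewhere. -/
def doubleAt (k : ℕ) (u : List Bool → ℝ) (t : List Bool) : ℝ :=
  if t[k]? = some false then 2 * u t else 0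

theorem doubleAt_append_false {k : ℕ} {u : List Bool → ℝ} (hu : DeterminedAt k u) {t : List Bool}
    (ht : t.length = k) : doubleAt k u (t ++ [false]) = 2 * u t := by
  subst ht
  simp [doubleAt, hu t false le_rfl]

theorem doubleAt_append_true {k : ℕ} {u : List Bool → ℝ} {t : List Bool}
    (ht : t.length = k) : doubleAt k u (t ++ [true]) = 0 := by
  subst ht
  simp [doubleAt]

theorem DeterminedAt.doubleAt {k : ℕ} {u : List Bool → ℝ} (hu : DeterminedAt k u) :
    DeterminedAt (k + 1) (doubleAt k u) := by
  intro t b ht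
  simp only [DaugavetL1.doubleAt, hu t b (by omega),
    List.getElem?_append_left (show k < t.length by omega)]

theorem avgAbs_doubleAt {k : ℕ} {u : List Bool → ℝ} (hu : DeterminedAt k u) :
    avgAbs (k + 1) (doubleAt k u) = avgAbs k u := by
  rw [avgAbs, sum_level_succ, avgAbs]
  refine Finset.sum_congr rfl fun t ht => ?_
  rw [doubleAt_append_false hu (mem_level.1 ht), doubleAt_append_true (mem_level.1 ht), abs_mul,
    abs_two, abs_zero]
  ring

/-- `doubleAt k u` is u·(1 + r) with r = ±1 according to entry k. The change in φ is half the jump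
weighted by u, and u is bounded, so the vanishing oscillation applies. -/
theorem IsTree.tendsto_doubleAt {e : List Bool → E} (he : IsTree e) (h1 : IsL1Tree e) {n : ℕ}
    {u : List Bool → ℝ} (hu : DeterminedAt n u) (φ : StrongDual ℝ E) :
    Tendsto (fun k => φ (vec e (k + 1) (doubleAt k u))) atTop (𝓝 (φ (vec e n u))) := by
  obtain ⟨C, hC⟩ : ∃ C, ∀ k, n ≤ k → ∀ t ∈ level k, |u t| ≤ C := by
    refine ⟨∑ t ∈ level n, |u t|, fun k hk => ?_⟩
    induction k, hk using Nat.le_induction with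
    | base =>
      exact fun t ht => Finset.single_le_sum (f := fun t => |u t|) (fun s _ => abs_nonneg _) ht
    | succ k hk ih =>
      intro t ht
      simp only [level, Finset.mem_biUnion, Finset.mem_insert, Finset.mem_singleton] at ht
      obtain ⟨s, hs, rfl | rfl⟩ := ht <;>
      · rw [hu _ _ (hk.trans (mem_level.1 hs).ge)]
        exact ih s hs
  have hdiff : ∀ k, n ≤ k → φ (vec e (k + 1) (doubleAt k u)) - φ (vec e n u) =
      ∑ t ∈ level k, (1 / 2 : ℝ) ^ k * (1 / 2 * u t *
        (φ (e (t ++ [false])) - φ (e (t ++ [true])))) := by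
    intro k hk
    rw [← he.vec_eq hu hk, vec, vec, sum_level_succ, map_sum, map_sum, ← Finset.sum_sub_distrib]
    refine Finset.sum_congr rfl fun t ht => ?_
    rw [doubleAt_append_false (hu.mono hk) (mem_level.1 ht),
      doubleAt_append_true (mem_level.1 ht), he t]
    simp only [map_add, map_smul, smul_eq_mul]
    ring
  rw [tendsto_iff_norm_sub_tendsto_zero]
  have hosc := (he.tendsto_oscillation h1 φ).const_mul (1 / 2 * C)
  rw [mul_zero] at hosc
  refine squeeze_zero' (Eventually.of_forall fun _ => norm_nonneg _) ?_ hosc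
  filter_upwards [eventually_ge_atTop n] with k hk
  rw [hdiff k hk, Finset.mul_sum]
  refine (norm_sum_le _ _).trans (Finset.sum_le_sum fun t ht => ?_)
  rw [Real.norm_eq_abs, abs_mul, abs_mul, abs_mul, abs_of_nonneg (by positivity : (0 : ℝ) ≤ (1 / 2) ^ k),
    abs_of_nonneg (by positivity : (0 : ℝ) ≤ 1 / 2)]
  have := hC k hk t ht
  have h2 : 1 / 2 * |u t| ≤ 1 / 2 * C := by linarith
  have := mul_le_mul_of_nonneg_right h2
    (show 0 ≤ (1 / 2 : ℝ) ^ k * |φ (e (t ++ [false])) - φ (e (t ++ [true]))| by positivity)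
  linarith

/-- Weakly close to a vector of the tree there are vectors of the same norm concentrated on a small
part of its support. -/
theorem IsTree.exists_concentrated {e : List Bool → E} (he : IsTree e) (h1 : IsL1Tree e)
    {V : Set (WeakSpace ℝ E)} (hV : IsOpen V) {n : ℕ} {u : List Bool → ℝ} (hu : DeterminedAt n u)
    (hmem : toWeakSpace ℝ E (vec e n u) ∈ V) (m : ℕ) :
    ∃ N w, n ≤ N ∧ DeterminedAt N w ∧ toWeakSpace ℝ E (vec e N w) ∈ V ∧
      avgAbs N w = avgAbs n u ∧ ∀ t, w t = 0 ∨ w t = 2 ^ m * u t := by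
  induction m with
  | zero => exact ⟨n, u, le_rfl, hu, hmem, rfl, fun t => by simp⟩
  | succ m ih =>
    obtain ⟨N, w, hN, hw, hwV, hwn, hwt⟩ := ih
    have hlim := tendsto_toWeakSpace (he.tendsto_doubleAt h1 hw)
    -- With k ≥ N the density w does not depend on entry k, so doubling preserves the norm.
    obtain ⟨k, hk, hkN⟩ := ((hlim.eventually (hV.mem_nhds hwV)).and (eventually_ge_atTop N)).exists
    refine ⟨k + 1, doubleAt k w, by omega, (hw.mono hkN).doubleAt, hk, ?_, fun t => ?_⟩
    · rw [avgAbs_doubleAt (hw.mono hkN), avgAbs_eq hw hkN, hwn]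
    · unfold doubleAt
      split_ifs
      · rcases hwt t with h | h
        · left; rw [h, mul_zero]
        · right; rw [h, pow_succ]; ring
      · exact Or.inl rfl

theorem IsTree.isSuperDeltaPoint {e : List Bool → E} (he : IsTree e) (h1 : IsL1Tree e)
    (hd : Dense (Submodule.span ℝ (range e) : Set E)) {y : E} (hy : ‖y‖ = 1) :
    IsSuperDeltaPoint y := by
  refine ⟨hy, ?_⟩
  rintro W ⟨V, hV, rfl⟩ hyW
  refine supDistEqTwo_of_forall hy inter_subset_left fun ε hε => ?_
  obtain ⟨m, hm⟩ : ∃ m : ℕ, (1 / 2 : ℝ) ^ m < ε / 4 :=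
    exists_pow_lt_of_lt_one (by linarith) (by norm_num)
  have hcont : ContinuousAt (fun x : E => ‖x‖⁻¹ • x) y :=
    (continuous_norm.continuousAt.inv₀ (by rw [hy]; norm_num)).smul continuousAt_id
  have hU : {x : E | toWeakSpace ℝ E x ∈ V ∧ ‖y - x‖ < ε / 2} ∈ 𝓝 (‖y‖⁻¹ • y) := by
    rw [hy, inv_one, one_smul]
    refine IsOpen.mem_nhds ?_ ⟨hyW.2, by simpa using hε⟩
    exact (hV.preimage (toWeakSpaceCLM ℝ E).continuous).inter
      (isOpen_lt (continuous_const.sub (continuous_id (X := E))).norm continuous_const)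
  have hne : ∀ᶠ x in 𝓝 y, x ≠ 0 := by
    refine isOpen_ne.mem_nhds ?_
    rintro rfl
    simp at hy
  -- Normalisation is continuous at y, so a vector of the dense span near y can be rescaled to norm
  -- one while staying in V and near y.
  obtain ⟨O, hO, hOo, hyO⟩ := eventually_nhds_iff.1 ((hcont.eventually hU).and hne)
  obtain ⟨x, hxO, hx⟩ := hd.inter_open_nonempty O hOo ⟨y, hyO⟩
  obtain ⟨⟨hxV, hxy⟩, hx0⟩ := hO x hxO
  obtain ⟨n, u, hu, hux⟩ := he.exists_vec (Submodule.smul_mem _ ‖x‖⁻¹ hx)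
  rw [← hux] at hxV hxy
  have hun : avgAbs n u = 1 := by
    rw [← h1.norm_vec (n := n), hux, norm_smul, norm_inv, norm_norm,
      inv_mul_cancel₀ (norm_ne_zero_iff.2 hx0)]
  obtain ⟨N, w, hnN, hw, hwV, hwn, hwt⟩ := he.exists_concentrated h1 hV hu hxV m
  refine ⟨vec e N w, ⟨?_, hwV⟩, ?_⟩
  · simp [h1.norm_vec, hwn, hun]
  · have hsub : vec e n u - vec e N w = vec e N (u - w) := by
      rw [← he.vec_eq hu hnN]
      simp only [vec, Pi.sub_apply, mul_sub, sub_smul, Finset.sum_sub_distrib]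
    have hlow : 2 - 2 * (1 / 2) ^ m ≤ ‖vec e n u - vec e N w‖ := by
      rw [hsub, h1.norm_vec]
      have h3 : (2 : ℝ) - 2 * (1 / 2) ^ m =
          avgAbs N u + avgAbs N w - 2 * (1 / 2) ^ m * avgAbs N w := by
        rw [avgAbs_eq hu hnN, hwn, hun]; ring
      rw [h3]
      simp only [avgAbs]
      rw [Finset.mul_sum, ← Finset.sum_add_distrib, ← Finset.sum_sub_distrib]
      refine Finset.sum_le_sum fun t _ => ?_
      -- Where w is non-zero, |u| = 2^{-m}|w|, and the left side is |w| - |u|.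
      have hpt : |u t| + |w t| - 2 * (1 / 2) ^ m * |w t| ≤ |u t - w t| := by
        rcases hwt t with h | h
        · simp [h]
        · have hw' : (1 / 2 : ℝ) ^ m * |w t| = |u t| := by
            rw [h, abs_mul, abs_of_nonneg (by positivity : (0 : ℝ) ≤ 2 ^ m), ← mul_assoc,
              ← mul_pow]
            norm_num
          have := abs_sub_abs_le_abs_sub (w t) (u t)
          rw [abs_sub_comm] at this
          linarith
      have := mul_le_mul_of_nonneg_left hpt (by positivity : (0 : ℝ) ≤ (1 / 2) ^ N)
      simp only [Pi.sub_apply]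
      linarith
    have htri : ‖vec e n u - vec e N w‖ ≤ ‖y - vec e n u‖ + ‖y - vec e N w‖ := by
      have : vec e n u - vec e N w = (y - vec e N w) - (y - vec e n u) := by abel
      rw [this, add_comm]
      exact norm_sub_le _ _
    linarith

end Super

/-! ### Normalised indicators and integration functionals in `L_1[0,1]` -/

/-- Lebesgue measure on `[0,1]`. -/
abbrev volI : Measure ℝ := volume.restrict (Icc (0 : ℝ) 1)

/-- The normalised indicator of a measurable set. -/
def normInd (S : Set ℝ) (hS : MeasurableSet S) : L1I :=
  (volI.real S)⁻¹ • indicatorConstLp 1 hS (measure_ne_top volI S) (1 : ℝ)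

/-- Integration over a set, as a functional on `L_1[0,1]`. -/
def setInt (S : Set ℝ) : L1I →L[ℝ] ℝ :=
  LinearMap.mkContinuous
    { toFun := fun x => ∫ a in S, x a ∂volI
      map_add' := fun x y => by
        rw [← integral_add (L1.integrable_coeFn x).integrableOn
          (L1.integrable_coeFn y).integrableOn]
        exact integral_congr_ae (ae_restrict_of_ae (Lp.coeFn_add x y))
      map_smul' := fun c x => by
        rw [RingHom.id_apply, smul_eq_mul, ← integral_const_mul]
        exact integral_congr_ae (ae_restrict_of_ae (Lp.coeFn_smul c x)) } 1 fun x => by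
    rw [one_mul, L1.norm_eq_integral_norm]
    exact (norm_integral_le_integral_norm _).trans (setIntegral_le_integral
      (L1.integrable_coeFn x).norm (Eventually.of_forall fun _ => norm_nonneg _))

theorem setInt_apply (S : Set ℝ) (x : L1I) : setInt S x = ∫ a in S, x a ∂volI := rfl

theorem abs_setInt_le_setIntegral (S : Set ℝ) (x : L1I) :
    |setInt S x| ≤ ∫ a in S, |x a| ∂volI :=
  norm_integral_le_integral_norm (μ := volI.restrict S) x

theorem setIntegral_abs_le_norm (S : Set ℝ) (x : L1I) : ∫ a in S, |x a| ∂volI ≤ ‖x‖ := by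
  rw [L1.norm_eq_integral_norm]
  exact setIntegral_le_integral
    (L1.integrable_coeFn x).norm (Eventually.of_forall fun a => abs_nonneg (x a))

theorem abs_setInt_le (S : Set ℝ) (x : L1I) : |setInt S x| ≤ ‖x‖ :=
  (abs_setInt_le_setIntegral S x).trans (setIntegral_abs_le_norm S x)

theorem sum_abs_setInt_le {ι : Type*} (F : Finset ι) (S : ι → Set ℝ)
    (hS : ∀ i ∈ F, MeasurableSet (S i)) (hd : (F : Set ι).PairwiseDisjoint S) (x : L1I) :
    ∑ i ∈ F, |setInt (S i) x| ≤ ‖x‖ := by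
  refine (Finset.sum_le_sum fun i _ => abs_setInt_le_setIntegral (S i) x).trans ?_
  rw [← integral_biUnion_finset F hS hd fun i _ => (L1.integrable_coeFn x).abs.integrableOn]
  exact setIntegral_abs_le_norm _ x

theorem coeFn_normInd (S : Set ℝ) (hS : MeasurableSet S) :
    normInd S hS =ᵐ[volI] fun a => (volI.real S)⁻¹ * S.indicator 1 a := by
  refine (Lp.coeFn_smul _ _).trans ?_
  filter_upwards [indicatorConstLp_coeFn (p := 1) (hs := hS) (hμs := measure_ne_top volI S)
    (c := (1 : ℝ))] with a ha
  rw [Pi.smul_apply, ha, smul_eq_mul]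
  rfl

theorem setInt_normInd {S S' : Set ℝ} (hS : MeasurableSet S) :
    setInt S' (normInd S hS) = (volI.real S)⁻¹ * volI.real (S' ∩ S) := by
  rw [setInt_apply, integral_congr_ae (ae_restrict_of_ae (coeFn_normInd S hS)),
    integral_const_mul]
  congr 1
  rw [setIntegral_indicator hS]
  simp

theorem setInt_normInd_of_disjoint {S S' : Set ℝ} (hS : MeasurableSet S)
    (h : Disjoint S' S) : setInt S' (normInd S hS) = 0 := by
  rw [setInt_normInd hS, h.inter_eq]
  simp

theorem setInt_normInd_of_subset {S S' : Set ℝ} (hS : MeasurableSet S)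
    (h : S ⊆ S') (h0 : volI.real S ≠ 0) : setInt S' (normInd S hS) = 1 := by
  rw [setInt_normInd hS, inter_eq_self_of_subset_right h, inv_mul_cancel₀ h0]

theorem norm_normInd {S : Set ℝ} (hS : MeasurableSet S) (h0 : volI.real S ≠ 0) :
    ‖normInd S hS‖ = 1 := by
  rw [normInd, norm_smul, norm_indicatorConstLp one_ne_zero ENNReal.one_ne_top]
  simp only [norm_inv, Real.norm_eq_abs, abs_of_nonneg (measureReal_nonneg : 0 ≤ volI.real S)]
  simp only [ENNReal.toReal_one, div_one, Real.rpow_one, abs_one, one_mul]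
  exact inv_mul_cancel₀ h0

/-! ### Dyadic trees of sets -/

/-- A dyadic tree of sets: each set is halved, in measure, by its two successors. -/
structure IsSetTree (S : List Bool → Set ℝ) : Prop where
  measurableSet : ∀ t, MeasurableSet (S t)
  union_eq : ∀ t, S t = S (t ++ [false]) ∪ S (t ++ [true])
  disjoint : ∀ t, Disjoint (S (t ++ [false])) (S (t ++ [true]))
  measure_eq : ∀ t b, volI (S (t ++ [b])) = volI (S t) / 2
  measure_ne_zero : volI (S []) ≠ 0

namespace IsSetTree

variable {S : List Bool → Set ℝ} (hS : IsSetTree S)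
include hS

theorem subset_append (t : List Bool) (b : Bool) : S (t ++ [b]) ⊆ S t := by
  rw [hS.union_eq t]
  cases b
  · exact subset_union_left
  · exact subset_union_right

theorem real_append (t : List Bool) (b : Bool) :
    volI.real (S (t ++ [b])) = volI.real (S t) / 2 := by
  rw [measureReal_def, hS.measure_eq, ENNReal.toReal_div]
  rfl

theorem real_eq (t : List Bool) : volI.real (S t) = volI.real (S []) / 2 ^ t.length := by
  induction t using List.reverseRecOn with
  | nil => simp
  | append_singleton t b ih => rw [hS.real_append, ih]; simp [pow_succ, div_div]

theorem real_pos (t : List Bool) : 0 < volI.real (S t) := by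
  rw [hS.real_eq]
  have : 0 < volI.real (S []) := ENNReal.toReal_pos hS.measure_ne_zero (measure_ne_top _ _)
  positivity

theorem disjoint_level {n : ℕ} {s t : List Bool} (hs : s ∈ level n) (ht : t ∈ level n)
    (hst : s ≠ t) : Disjoint (S s) (S t) := by
  induction n generalizing s t with
  | zero => simp_all [level]
  | succ n ih =>
    simp only [level, Finset.mem_biUnion, Finset.mem_insert, Finset.mem_singleton] at hs ht
    obtain ⟨s, hs, hs'⟩ := hs
    obtain ⟨t, ht, ht'⟩ := ht
    by_cases h : s = t
    · subst h
      rcases hs' with rfl | rfl <;> rcases ht' with rfl | rfl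
      · exact absurd rfl hst
      · exact hS.disjoint s
      · exact (hS.disjoint s).symm
      · exact absurd rfl hst
    · rcases hs' with rfl | rfl <;> rcases ht' with rfl | rfl <;>
      exact (ih hs ht h).mono (hS.subset_append _ _) (hS.subset_append _ _)

theorem exists_mem_level {x : ℝ} (hx : x ∈ S []) (n : ℕ) : ∃ t ∈ level n, x ∈ S t := by
  induction n with
  | zero => exact ⟨[], by simp [level], hx⟩
  | succ n ih =>
    obtain ⟨t, ht, hxt⟩ := ih
    rw [hS.union_eq t] at hxt
    simp only [level, Finset.mem_biUnion, Finset.mem_insert, Finset.mem_singleton]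
    rcases hxt with h | h
    · exact ⟨_, ⟨t, ht, Or.inl rfl⟩, h⟩
    · exact ⟨_, ⟨t, ht, Or.inr rfl⟩, h⟩

theorem setInt_normInd_level {n : ℕ} {s t : List Bool} (hs : s ∈ level n) (ht : t ∈ level n) :
    setInt (S s) (normInd (S t) (hS.measurableSet t)) = if s = t then 1 else 0 := by
  split_ifs with h
  · subst h
    exact setInt_normInd_of_subset _ subset_rfl (hS.real_pos s).ne'
  · exact setInt_normInd_of_disjoint _ (hS.disjoint_level hs ht h)

theorem setInt_sum {n : ℕ} {s : List Bool} (hs : s ∈ level n) (a : List Bool → ℝ) :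
    setInt (S s) (∑ t ∈ level n, a t • normInd (S t) (hS.measurableSet t)) = a s := by
  rw [map_sum, Finset.sum_eq_single s]
  · rw [map_smul, hS.setInt_normInd_level hs hs, if_pos rfl, smul_eq_mul, mul_one]
  · intro t ht hts
    rw [map_smul, hS.setInt_normInd_level hs ht, if_neg hts.symm, smul_zero]
  · exact fun h => absurd hs h

theorem isTree : IsTree fun t => normInd (S t) (hS.measurableSet t) := by
  intro t
  simp only [normInd, hS.real_append]
  have h : indicatorConstLp 1 (hS.measurableSet t) (measure_ne_top volI (S t)) (1 : ℝ) =
      indicatorConstLp 1 (hS.measurableSet (t ++ [false]))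
        (measure_ne_top volI (S (t ++ [false]))) (1 : ℝ) +
      indicatorConstLp 1 (hS.measurableSet (t ++ [true]))
        (measure_ne_top volI (S (t ++ [true]))) (1 : ℝ) := by
    rw [← indicatorConstLp_disjoint_union _ _ _ _ (hS.disjoint t)]
    congr 1
    exact hS.union_eq t
  rw [h, ← smul_add, smul_smul]
  congr 1
  field_simp

theorem pairwiseDisjoint_level (n : ℕ) :
    ((level n : Finset (List Bool)) : Set (List Bool)).PairwiseDisjoint S :=
  fun _ hs _ ht hst => hS.disjoint_level hs ht hst

/-- Sets of one level are disjoint; integrating over each recovers its coefficient, which gives the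
lower bound. -/
theorem isL1Tree : IsL1Tree fun t => normInd (S t) (hS.measurableSet t) := by
  intro n a
  refine le_antisymm ?_ ?_
  · refine (norm_sum_le _ _).trans (Finset.sum_le_sum fun t _ => ?_)
    rw [norm_smul, norm_normInd _ (hS.real_pos t).ne', mul_one, Real.norm_eq_abs]
  · have h := sum_abs_setInt_le (level n) S (fun t _ => hS.measurableSet t)
      (hS.pairwiseDisjoint_level n) (∑ t ∈ level n, a t • normInd (S t) (hS.measurableSet t))
    rwa [Finset.sum_congr rfl fun s hs => by rw [hS.setInt_sum hs a]] at h

end IsSetTree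

/-! ### Trees of unions of dyadic intervals -/

theorem foldl_half_append (I : ℝ × ℝ) (t : List Bool) (b : Bool) :
    (t ++ [b]).foldl half I = half (t.foldl half I) b := by
  rw [List.foldl_append]; rfl

theorem foldl_half_length (I : ℝ × ℝ) (t : List Bool) :
    (t.foldl half I).2 - (t.foldl half I).1 = (I.2 - I.1) / 2 ^ t.length := by
  induction t using List.reverseRecOn with
  | nil => simp
  | append_singleton t b ih =>
    rw [foldl_half_append, List.length_append, List.length_singleton, pow_succ, ← div_div, ← ih]
    cases b <;> simp [half] <;> ring

theorem foldl_half_le {I : ℝ × ℝ} (hI : I.1 ≤ I.2) (t : List Bool) :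
    (t.foldl half I).1 ≤ (t.foldl half I).2 := by
  have := foldl_half_length I t
  have : 0 ≤ (I.2 - I.1) / 2 ^ t.length := div_nonneg (by linarith) (by positivity)
  linarith

theorem subInterval_subset {I : ℝ × ℝ} (hI : I.1 ≤ I.2) (t : List Bool) :
    subInterval I t ⊆ Ico I.1 I.2 :=
  Ico_subset_Ico (foldl_half_mem t I hI).1 (foldl_half_mem t I hI).2

theorem subInterval_append_union {I : ℝ × ℝ} (hI : I.1 ≤ I.2) (t : List Bool) :
    subInterval I t = subInterval I (t ++ [false]) ∪ subInterval I (t ++ [true]) := by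
  have := foldl_half_le hI t
  simp only [subInterval, foldl_half_append, half]
  simp only [Bool.false_eq_true, if_false, if_true]
  rw [Ico_union_Ico_eq_Ico] <;> linarith

theorem subInterval_append_disjoint (I : ℝ × ℝ) (t : List Bool) :
    Disjoint (subInterval I (t ++ [false])) (subInterval I (t ++ [true])) := by
  simp only [subInterval, foldl_half_append, half]
  simp only [Bool.false_eq_true, if_false, if_true]
  exact Ico_disjoint_Ico_same

theorem volI_Ico {a b : ℝ} (ha : 0 ≤ a) (hb : b ≤ 1) : volI (Ico a b) = ENNReal.ofReal (b - a) := by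
  rw [Measure.restrict_apply measurableSet_Ico, inter_eq_self_of_subset_left, Real.volume_Ico]
  exact fun x hx => ⟨ha.trans hx.1, hx.2.le.trans hb⟩

theorem volI_subInterval {I : ℝ × ℝ} (h0 : 0 ≤ I.1) (h1 : I.1 ≤ I.2) (h2 : I.2 ≤ 1)
    (t : List Bool) : volI (subInterval I t) = ENNReal.ofReal ((I.2 - I.1) / 2 ^ t.length) := by
  have := foldl_half_mem t I h1
  rw [subInterval, volI_Ico (h0.trans this.1) (this.2.trans h2), foldl_half_length]

/-- Common source of all set trees used here: disjoint intervals are halved in parallel, and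
countable additivity halves the total measure. -/
theorem isSetTree_iUnion {ι : Type*} [Countable ι] [Nonempty ι] {I : ι → ℝ × ℝ}
    (hI : ∀ i, 0 ≤ (I i).1 ∧ (I i).1 < (I i).2 ∧ (I i).2 ≤ 1)
    (hd : Pairwise fun i j => Disjoint (Ico (I i).1 (I i).2) (Ico (I j).1 (I j).2)) :
    IsSetTree fun t => ⋃ i, subInterval (I i) t := by
  have hd' : ∀ s t i j, i ≠ j → Disjoint (subInterval (I i) s) (subInterval (I j) t) :=
    fun s t i j hij => (hd hij).mono (subInterval_subset (hI i).2.1.le s)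
      (subInterval_subset (hI j).2.1.le t)
  refine ⟨fun t => MeasurableSet.iUnion fun i => measurableSet_subInterval _ _, fun t => ?_,
    fun t => ?_, fun t b => ?_, ?_⟩
  · rw [← iUnion_union_distrib]
    exact iUnion_congr fun i => subInterval_append_union (hI i).2.1.le t
  · simp only [disjoint_iUnion_left, disjoint_iUnion_right]
    intro i j
    by_cases hij : j = i
    · subst hij; exact subInterval_append_disjoint _ _
    · exact hd' _ _ _ _ hij
  · rw [measure_iUnion (fun i j hij => hd' _ _ i j hij) fun i => measurableSet_subInterval _ _,
      measure_iUnion (fun i j hij => hd' _ _ i j hij) fun i => measurableSet_subInterval _ _,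
      div_eq_mul_inv, ← ENNReal.tsum_mul_right]
    refine tsum_congr fun i => ?_
    rw [volI_subInterval (hI i).1 (hI i).2.1.le (hI i).2.2,
      volI_subInterval (hI i).1 (hI i).2.1.le (hI i).2.2, List.length_append, List.length_singleton,
      pow_succ, ← div_div, ENNReal.ofReal_div_of_pos two_pos, ENNReal.ofReal_ofNat, div_eq_mul_inv]
  · obtain ⟨i⟩ := ‹Nonempty ι›
    refine fun h => ?_
    have h0 := measure_mono_null (subset_iUnion (fun i => subInterval (I i) []) i) h
    rw [volI_subInterval (hI i).1 (hI i).2.1.le (hI i).2.2] at h0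
    simp at h0
    linarith [(hI i).2.1]

/-! ### The dyadic tree of `[0,1)` -/

/-- The dyadic subintervals of `[0,1)`. -/
def setD (t : List Bool) : Set ℝ := ⋃ _ : Unit, subInterval (0, 1) t

/-- The one-term union over `Unit` in `setD` makes `isSetTree_iUnion` apply. -/
theorem isSetTree_setD : IsSetTree setD :=
  isSetTree_iUnion (fun _ => by norm_num) fun i j hij => absurd (Subsingleton.elim i j) hij

theorem setD_eq (t : List Bool) : setD t = subInterval (0, 1) t := iUnion_const _

/-- Bounded continuous functions are dense in L₁; by uniform continuity on [0,1] each is uniformly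
close to the step function of its values at left end points of dyadic intervals. -/
theorem dense_span_normInd_setD : Dense (Submodule.span ℝ (range fun t =>
    normInd (setD t) (isSetTree_setD.measurableSet t)) : Set L1I) := by
  set W := Submodule.span ℝ (range fun t => normInd (setD t) (isSetTree_setD.measurableSet t))
  have hdense := BoundedContinuousFunction.toLp_denseRange (E := ℝ) ℝ (p := 1) (μ := volI)
    ENNReal.one_ne_top
  rw [← dense_closure]
  refine hdense.mono ?_
  rintro _ ⟨g, rfl⟩
  rw [Metric.mem_closure_iff]
  intro ε hε
  have huc : UniformContinuousOn g (Icc 0 1) :=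
    isCompact_Icc.uniformContinuousOn_of_continuous g.continuous.continuousOn
  obtain ⟨δ, hδ, hg⟩ := Metric.uniformContinuousOn_iff.1 huc (ε / 2) (by linarith)
  obtain ⟨n, hn⟩ : ∃ n : ℕ, (1 / 2 : ℝ) ^ n < δ := exists_pow_lt_of_lt_one hδ (by norm_num)
  set c : List Bool → ℝ := fun t => g (t.foldl half (0, 1)).1
  refine ⟨∑ t ∈ level n, (c t * volI.real (setD t)) •
    normInd (setD t) (isSetTree_setD.measurableSet t), ?_, ?_⟩
  · exact Submodule.sum_mem _ fun t _ => Submodule.smul_mem _ _ (Submodule.subset_span ⟨t, rfl⟩)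
  · rw [dist_eq_norm]
    have hsum : (∑ t ∈ level n, (c t * volI.real (setD t)) •
        normInd (setD t) (isSetTree_setD.measurableSet t) : L1I) =
        ∑ t ∈ level n, c t • indicatorConstLp 1 (isSetTree_setD.measurableSet t)
          (measure_ne_top volI (setD t)) (1 : ℝ) := by
      refine Finset.sum_congr rfl fun t _ => ?_
      rw [normInd, smul_smul, mul_assoc, mul_inv_cancel₀ (isSetTree_setD.real_pos t).ne', mul_one]
    rw [hsum]
    have hcoe : ∀ᵐ x ∂volI, (∑ t ∈ level n, c t • indicatorConstLp 1
        (isSetTree_setD.measurableSet t) (measure_ne_top volI (setD t)) (1 : ℝ) : L1I) x =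
        ∑ t ∈ level n, c t * (setD t).indicator 1 x := by
      have h1 : ∀ᵐ x ∂volI, ∀ t ∈ level n, (c t • indicatorConstLp 1
          (isSetTree_setD.measurableSet t) (measure_ne_top volI (setD t)) (1 : ℝ) : L1I) x =
          c t * (setD t).indicator 1 x := by
        refine (ae_ball_iff (Finset.countable_toSet (level n))).2 ?_
        intro t _
        filter_upwards [Lp.coeFn_smul (c t) (indicatorConstLp 1
          (isSetTree_setD.measurableSet t) (measure_ne_top volI (setD t)) (1 : ℝ)),
          indicatorConstLp_coeFn (p := 1) (hs := isSetTree_setD.measurableSet t)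
            (hμs := measure_ne_top volI (setD t)) (c := (1 : ℝ))] with x hx hx'
        rw [hx, Pi.smul_apply, hx', smul_eq_mul]
        rfl
      filter_upwards [Lp.coeFn_finsetSum (level n) fun t => (c t • indicatorConstLp 1
          (isSetTree_setD.measurableSet t) (measure_ne_top volI (setD t)) (1 : ℝ) : L1I), h1]
        with x hx hx'
      rw [hx, Finset.sum_apply]
      exact Finset.sum_congr rfl hx'
    have hIco : ∀ᵐ x ∂volI, x ∈ Ico (0 : ℝ) 1 := by
      rw [volI, ← restrict_Ico_eq_restrict_Icc]
      exact ae_restrict_mem measurableSet_Ico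
    refine lt_of_le_of_lt (Lp.norm_le_of_ae_bound (C := ε / 2) (by linarith) ?_) ?_
    · filter_upwards [hcoe, hIco, Lp.coeFn_sub (BoundedContinuousFunction.toLp (E := ℝ) 1 volI ℝ g)
        (∑ t ∈ level n, c t • indicatorConstLp 1 (isSetTree_setD.measurableSet t)
          (measure_ne_top volI (setD t)) (1 : ℝ)),
        BoundedContinuousFunction.coeFn_toLp (𝕜 := ℝ) 1 volI g] with x h1 h2 h3 h4
      rw [h3, Pi.sub_apply, h1, h4]
      obtain ⟨t, ht, hxt⟩ := isSetTree_setD.exists_mem_level (x := x)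
        (by rw [setD_eq]; exact h2) n
      rw [Finset.sum_eq_single t]
      · rw [indicator_of_mem hxt, Pi.one_apply, mul_one]
        rw [setD_eq] at hxt
        have hlen := foldl_half_length (0, 1) t
        have hmem := foldl_half_mem t (0, 1) zero_le_one
        rw [mem_level.1 ht] at hlen
        simp only [subInterval, mem_Ico] at hxt
        simp only [sub_zero, one_div] at hlen hn hmem
        rw [inv_pow] at hn
        have := hg x ⟨h2.1, h2.2.le⟩ (t.foldl half (0, 1)).1
          ⟨hmem.1, by linarith⟩ (by rw [Real.dist_eq, abs_of_nonneg] <;> linarith)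
        exact this.le
      · intro s hs hst
        rw [indicator_of_notMem, mul_zero]
        exact fun hxs => (isSetTree_setD.disjoint_level hs ht hst).ne_of_mem hxs hxt rfl
      · exact fun h => absurd ht h
    · have hm : measureUnivNNReal volI = 1 := by
        rw [← ENNReal.coe_inj, coe_measureUnivNNReal]
        simp
      simp [hm]
      linarith

/-! ### The supports of `f_t` and `h_t` -/

/-- The support `⋃_{i ≥ 1} B_i^t` of `h_t`. -/
def setH (t : List Bool) : Set ℝ := ⋃ i : ℕ, setB (i + 1) t

/-- The set `C_k^t ∪ B_1^t ∪ ⋯ ∪ B_k^t`; for `k = |t|` it is the support of `f_t`. -/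
def setF (k : ℕ) (t : List Bool) : Set ℝ := setC k t ∪ ⋃ i ∈ Finset.Icc 1 k, setB i t

theorem one_div_two_pow_succ_lt (n : ℕ) : (1 / 2 ^ (n + 1) : ℝ) < 1 / 2 ^ n :=
  one_div_lt_one_div_of_lt (by positivity) (pow_lt_pow_right₀ one_lt_two (Nat.lt_succ_self n))

theorem one_div_two_pow_le {m n : ℕ} (h : m ≤ n) : (1 / 2 ^ n : ℝ) ≤ 1 / 2 ^ m :=
  one_div_le_one_div_of_le (by positivity) (pow_le_pow_right₀ one_le_two h)

theorem disjoint_Ico_two_pow {i j : ℕ} (hij : i ≠ j) :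
    Disjoint (Ico (1 / 2 ^ (i + 1) : ℝ) (1 / 2 ^ i)) (Ico (1 / 2 ^ (j + 1)) (1 / 2 ^ j)) := by
  rcases hij.lt_or_gt with h | h
  · exact (Ico_disjoint_Ico.2 ((min_le_right _ _).trans
      ((one_div_two_pow_le h).trans (le_max_left _ _))))
  · exact (Ico_disjoint_Ico.2 ((min_le_left _ _).trans
      ((one_div_two_pow_le h).trans (le_max_right _ _))))

theorem setB_disjoint {i j : ℕ} (hij : i ≠ j) (s t : List Bool) :
    Disjoint (setB i s) (setB j t) :=
  (disjoint_Ico_two_pow hij).mono (setB_subset i s) (setB_subset j t)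

theorem setC_subset (n : ℕ) (t : List Bool) :
    setC n t ⊆ Ico (1 / 2 + 1 / 2 ^ (n + 1) : ℝ) (1 / 2 + 1 / 2 ^ n) :=
  subInterval_subset (by have := one_div_two_pow_succ_lt n; simp only; linarith) t

theorem lt_half_of_mem_setB {i : ℕ} (hi : 1 ≤ i) {t : List Bool} {x : ℝ} (hx : x ∈ setB i t) :
    x < 1 / 2 := by
  have h1 := (setB_subset i t hx).2
  have h2 : (1 / 2 ^ i : ℝ) ≤ 1 / 2 ^ 1 := one_div_two_pow_le hi
  rw [pow_one] at h2
  linarith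

theorem half_lt_of_mem_setC {n : ℕ} {t : List Bool} {x : ℝ} (hx : x ∈ setC n t) : 1 / 2 < x := by
  have h1 := (setC_subset n t hx).1
  have h2 : (0 : ℝ) < 1 / 2 ^ (n + 1) := by positivity
  linarith

theorem setC_disjoint_setB {i n : ℕ} (hi : 1 ≤ i) (s t : List Bool) :
    Disjoint (setC n s) (setB i t) :=
  disjoint_left.2 fun _ hx hx' =>
    absurd (half_lt_of_mem_setC hx) (lt_half_of_mem_setB hi hx').le.not_gt

theorem setC_disjoint {m n : ℕ} (hmn : m ≠ n) (s t : List Bool) :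
    Disjoint (setC m s) (setC n t) := by
  refine disjoint_left.2 fun x hx hx' => ?_
  have h1 := setC_subset m s hx
  have h2 := setC_subset n t hx'
  refine (disjoint_Ico_two_pow hmn).notMem_of_mem_left (a := x - 1 / 2) ?_ ?_
  · exact ⟨by linarith [h1.1], by linarith [h1.2]⟩
  · exact ⟨by linarith [h2.1], by linarith [h2.2]⟩

theorem isSetTree_setH : IsSetTree setH := by
  refine isSetTree_iUnion (I := fun i : ℕ => (1 / 2 ^ (i + 1 + 1), 1 / 2 ^ (i + 1)))
    (fun i => ⟨by positivity, one_div_two_pow_succ_lt _, ?_⟩) fun i j hij => ?_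
  · exact div_le_one_of_le₀ (one_le_pow₀ one_le_two) (by positivity)
  · exact disjoint_Ico_two_pow (by simpa using hij)

theorem isSetTree_setF {k : ℕ} (hk : 1 ≤ k) : IsSetTree (setF k) := by
  -- `none` indexes the interval C_k, `some i` the interval B_i.
  set I : Option (Finset.Icc 1 k) → ℝ × ℝ := fun o =>
    o.elim (1 / 2 + 1 / 2 ^ (k + 1), 1 / 2 + 1 / 2 ^ k) fun i => (1 / 2 ^ (i.1 + 1), 1 / 2 ^ i.1)
    with hI
  have hF : setF k = fun t => ⋃ o, subInterval (I o) t := by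
    funext t
    rw [iUnion_option, iUnion_subtype]
    rfl
  rw [hF]
  have hle : ∀ i, 1 ≤ i → (1 / 2 ^ i : ℝ) ≤ 1 / 2 := fun i hi => by
    have := one_div_two_pow_le hi
    rwa [pow_one] at this
  have hdCB : ∀ i : Finset.Icc 1 k, Disjoint (Ico (I none).1 (I none).2)
      (Ico (I (some i)).1 (I (some i)).2) := fun i =>
    setC_disjoint_setB (n := k) (Finset.mem_Icc.1 i.2).1 [] []
  refine isSetTree_iUnion ?_ ?_
  · rintro (_ | i)
    · have := hle k hk
      have := one_div_two_pow_succ_lt k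
      exact ⟨by simp only [hI, Option.elim]; positivity, by simp only [hI, Option.elim]; linarith,
        by simp only [hI, Option.elim]; linarith⟩
    · have := hle i.1 (Finset.mem_Icc.1 i.2).1
      exact ⟨by simp only [hI, Option.elim]; positivity, one_div_two_pow_succ_lt _,
        by simp only [hI, Option.elim]; linarith⟩
  · rintro (_ | i) (_ | j) hij
    · exact absurd rfl hij
    · exact hdCB j
    · exact (hdCB i).symm
    · exact disjoint_Ico_two_pow fun h => hij (congrArg some (Subtype.ext h))

theorem real_setB {i : ℕ} (t : List Bool) :
    volI.real (setB i t) = 1 / 2 ^ (i + 1) / 2 ^ t.length := by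
  rw [measureReal_def, setB, volI_subInterval (by positivity) (one_div_two_pow_succ_lt i).le
    (div_le_one_of_le₀ (one_le_pow₀ one_le_two) (by positivity)), ENNReal.toReal_ofReal]
  · congr 1
    simp only
    field_simp
    ring
  · exact div_nonneg (sub_nonneg.2 (one_div_two_pow_succ_lt i).le) (by positivity)

theorem real_setC {n : ℕ} (hn : 1 ≤ n) (t : List Bool) :
    volI.real (setC n t) = 1 / 2 ^ (n + 1) / 2 ^ t.length := by
  have h1 := one_div_two_pow_succ_lt n
  have h2 := one_div_two_pow_le hn
  rw [pow_one] at h2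
  rw [measureReal_def, setC, volI_subInterval (by positivity) (by simp only; linarith)
    (by simp only; linarith), ENNReal.toReal_ofReal]
  · congr 1
    simp only
    field_simp
    ring
  · exact div_nonneg (by simp only; linarith) (by positivity)

/-- C_k has measure 2^{-(k+1)}, exactly what B_1, …, B_k lack to total 1/2. So f_t is a normalised
indicator, with the same constant as h_t. -/
theorem real_setF {k : ℕ} (hk : 1 ≤ k) (t : List Bool) :
    volI.real (setF k t) = 1 / 2 ^ (t.length + 1) := by
  have h0 : volI.real (setF k []) = 1 / 2 := by
    have hm : MeasurableSet (⋃ i ∈ Finset.Icc 1 k, setB i []) :=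
      Finset.measurableSet_biUnion _ fun i _ => measurableSet_subInterval _ _
    rw [setF, measureReal_union ?_ hm (measure_ne_top _ _) (measure_ne_top _ _),
      measureReal_biUnion_finset
      (fun i _ j _ hij => setB_disjoint hij _ _) fun i _ => measurableSet_subInterval _ _,
      real_setC hk]
    · simp only [real_setB, List.length_nil, pow_zero, div_one]
      clear hm hk
      induction k with
      | zero => simp
      | succ k ih =>
        rw [Finset.sum_Icc_succ_top (by omega), ← ih]
        field_simp
        ring
    · simp only [disjoint_iUnion_right]
      exact fun i hi => setC_disjoint_setB (Finset.mem_Icc.1 hi).1 _ _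
  rw [(isSetTree_setF hk).real_eq, h0, div_div, pow_succ']

theorem real_setH (t : List Bool) : volI.real (setH t) = 1 / 2 ^ (t.length + 1) := by
  have h0 : volI.real (setH []) = 1 / 2 := by
    have hs : ∀ i : ℕ, volI (setB (i + 1) []) = ENNReal.ofReal (1 / 2 / 2 / 2 ^ i) := by
      intro i
      rw [← ENNReal.ofReal_toReal (measure_ne_top volI (setB (i + 1) [])), ← measureReal_def,
        real_setB]
      congr 1
      simp only [List.length_nil, pow_zero, div_one, pow_succ]
      field_simp
    rw [measureReal_def, setH, measure_iUnion (fun i j hij => setB_disjoint (by simpa using hij) _ _)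
      fun i => measurableSet_subInterval _ _]
    simp only [hs]
    rw [← ENNReal.ofReal_tsum_of_nonneg (fun i => by positivity) (summable_geometric_two' _),
      tsum_geometric_two', ENNReal.toReal_ofReal (by norm_num)]
  rw [isSetTree_setH.real_eq, h0, div_div, pow_succ']

theorem fFun_eq {t : List Bool} (ht : t ≠ []) (x : ℝ) :
    fFun t x = (volI.real (setF t.length t))⁻¹ * (setF t.length t).indicator 1 x := by
  rw [real_setF (List.length_pos_iff.2 ht), one_div, inv_inv, fFun, setF,
    indicator_union_of_disjoint]
  · beta_reduce
    rw [Finset.indicator_biUnion_apply]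
    · exact fun i _ j _ hij => setB_disjoint hij _ _
  · simp only [disjoint_iUnion_right]
    exact fun i hi => setC_disjoint_setB (Finset.mem_Icc.1 hi).1 _ _

theorem f_eq {t : List Bool} (ht : t ≠ []) : f t = normInd (setF t.length t)
    ((isSetTree_setF (List.length_pos_iff.2 ht)).measurableSet t) := by
  refine Lp.ext (((memLp_fFun t).coeFn_toLp).trans ?_)
  filter_upwards [coeFn_normInd (setF t.length t)
    ((isSetTree_setF (List.length_pos_iff.2 ht)).measurableSet t)] with x hx
  rw [hx, fFun_eq ht]

theorem h_eq (t : List Bool) : h t = normInd (setH t) (isSetTree_setH.measurableSet t) := by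
  refine Lp.ext (((memLp_hFun t).coeFn_toLp).trans ?_)
  filter_upwards [coeFn_normInd (setH t) (isSetTree_setH.measurableSet t)] with x hx
  rw [hx, real_setH, one_div, inv_inv, hFun_eq]
  rfl

/-! ### The inclusion of `Y` in `X` -/

theorem f_mem_spaceX {t : List Bool} (ht : t ≠ []) : f t ∈ spaceX :=
  Submodule.le_topologicalClosure _ (Submodule.subset_span ⟨t, ht, rfl⟩)

/-- The average of the `f_s` over the extensions `s` of `t` of length `k` is the normalised
indicator of `setF k t`. -/
theorem normInd_setF_mem_span {k : ℕ} (hk : 1 ≤ k) (t : List Bool) (htk : t.length ≤ k) :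
    normInd (setF k t) ((isSetTree_setF hk).measurableSet t) ∈
      Submodule.span ℝ (f '' (level k : Set (List Bool))) := by
  obtain ⟨d, hd⟩ := Nat.exists_eq_add_of_le htk
  induction d generalizing t with
  | zero =>
    have hne : t ≠ [] := by rintro rfl; simp at hd; omega
    have hf := f_eq hne
    simp only [show t.length = k by omega] at hf
    rw [← hf]
    exact Submodule.subset_span ⟨t, mem_level.2 (by omega), rfl⟩
  | succ d ih =>
    have h := (isSetTree_setF hk).isTree t
    simp only at h
    rw [h]
    exact Submodule.smul_mem _ _ (Submodule.add_mem _ (ih _ (by simp; omega) (by simp; omega))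
      (ih _ (by simp; omega) (by simp; omega)))

/-- The normalising constants agree, and the supports differ only inside C_{k+1} and [0,
2^{-(k+1)}), sets of vanishing measure. -/
theorem tendsto_normInd_setF (t : List Bool) :
    Tendsto (fun k : ℕ => normInd (setF (k + 1) t)
      ((isSetTree_setF (Nat.le_add_left 1 k)).measurableSet t)) atTop (𝓝 (h t)) := by
  rw [h_eq]
  simp only [normInd, real_setF (Nat.le_add_left 1 _), real_setH]
  refine Tendsto.const_smul ?_ _
  refine tendsto_indicatorConstLp_set ENNReal.one_ne_top ?_
  have hsub : ∀ k : ℕ, symmDiff (setF (k + 1) t) (setH t) ⊆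
      Ico (1 / 2 + 1 / 2 ^ (k + 1 + 1) : ℝ) (1 / 2 + 1 / 2 ^ (k + 1)) ∪
      Ico 0 (1 / 2 ^ (k + 1)) := by
    rintro k x (⟨hx, hx'⟩ | ⟨hx, hx'⟩)
    · left
      rcases hx with hx | hx
      · exact setC_subset _ _ hx
      · simp only [mem_iUnion] at hx
        obtain ⟨i, hi, hx⟩ := hx
        refine absurd (mem_iUnion.2 ⟨i - 1, ?_⟩) hx'
        rwa [Nat.sub_add_cancel (Finset.mem_Icc.1 hi).1]
    · right
      obtain ⟨i, hx⟩ := mem_iUnion.1 hx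
      have hik : k + 1 ≤ i + 1 := by
        by_contra hlt
        refine hx' (Or.inr ?_)
        simp only [mem_iUnion]
        exact ⟨i + 1, Finset.mem_Icc.2 ⟨by omega, by omega⟩, hx⟩
      have := setB_subset _ _ hx
      exact ⟨le_trans (by positivity) this.1, this.2.trans_le (one_div_two_pow_le hik)⟩
  have hbound : ∀ k : ℕ, volI (symmDiff (setF (k + 1) t) (setH t)) ≤
      ENNReal.ofReal (2 * (1 / 2) ^ (k + 1)) := by
    intro k
    refine (measure_mono (hsub k)).trans ((measure_union_le _ _).trans ?_)
    have h1 := one_div_two_pow_le (show 1 ≤ k + 1 by omega)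
    have h2 := one_div_two_pow_succ_lt (k + 1)
    have h3 : (0 : ℝ) < 1 / 2 ^ (k + 1 + 1) := by positivity
    rw [pow_one] at h1
    rw [volI_Ico (by positivity) (by linarith), volI_Ico le_rfl (by linarith),
      ← ENNReal.ofReal_add (by linarith) (by linarith)]
    refine ENNReal.ofReal_le_ofReal ?_
    rw [one_div_pow]
    linarith
  refine tendsto_of_tendsto_of_tendsto_of_le_of_le tendsto_const_nhds ?_ (fun k => zero_le)
    hbound
  have h0 : Tendsto (fun k : ℕ => 2 * (1 / 2 : ℝ) ^ (k + 1)) atTop (𝓝 0) := by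
    have := ((tendsto_pow_atTop_nhds_zero_of_lt_one (r := (1 / 2 : ℝ)) (by norm_num)
      (by norm_num)).comp (tendsto_add_atTop_nat 1)).const_mul 2
    simpa using this
  have := ENNReal.tendsto_ofReal h0
  rwa [ENNReal.ofReal_zero] at this

theorem span_level_le_spaceX {k : ℕ} (hk : 1 ≤ k) :
    Submodule.span ℝ (f '' (level k : Set (List Bool))) ≤ spaceX := by
  refine Submodule.span_le.2 ?_
  rintro _ ⟨s, hs, rfl⟩
  refine f_mem_spaceX ?_
  rintro rfl
  have := mem_level.1 hs
  simp at this
  omega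

theorem h_mem_spaceX (t : List Bool) : h t ∈ spaceX := by
  refine (Submodule.isClosed_topologicalClosure _).mem_of_tendsto (tendsto_normInd_setF t) ?_
  filter_upwards [eventually_ge_atTop t.length] with k hk
  exact span_level_le_spaceX (by omega) (normInd_setF_mem_span (Nat.le_add_left 1 k) t (by omega))

theorem spaceY_le_spaceX : spaceY ≤ spaceX := by
  refine Submodule.topologicalClosure_minimal _ (Submodule.span_le.2 ?_)
    (Submodule.isClosed_topologicalClosure _)
  rintro _ ⟨t, -, rfl⟩
  exact h_mem_spaceX t

/-! ### The tree of `Y` -/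

theorem isTree_h : IsTree h := by
  have := isSetTree_setH.isTree
  simp only [← h_eq] at this
  exact this

theorem isL1Tree_h : IsL1Tree h := by
  have := isSetTree_setH.isL1Tree
  simp only [← h_eq] at this
  exact this

/-- The root, absent from T, is the average of its two successors. -/
theorem span_range_h : Submodule.span ℝ (range h) = Submodule.span ℝ (h '' tree) := by
  refine le_antisymm (Submodule.span_le.2 ?_) (Submodule.span_mono (image_subset_range _ _))
  rintro _ ⟨t, rfl⟩
  by_cases ht : t = []
  · subst ht
    rw [isTree_h []]
    exact Submodule.smul_mem _ _ (Submodule.add_mem _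
      (Submodule.subset_span ⟨[false], by simp [tree], rfl⟩)
      (Submodule.subset_span ⟨[true], by simp [tree], rfl⟩))
  · exact Submodule.subset_span ⟨t, ht, rfl⟩

theorem h_mem_spaceY (t : List Bool) : h t ∈ spaceY := by
  rw [spaceY, ← span_range_h]
  exact Submodule.le_topologicalClosure _ (Submodule.subset_span ⟨t, rfl⟩)

/-- The vectors `h_t` as elements of `Y`. -/
def hY (t : List Bool) : spaceY := ⟨h t, h_mem_spaceY t⟩

theorem isTree_hY : IsTree hY := fun t => Subtype.ext (isTree_h t)

theorem isL1Tree_hY : IsL1Tree hY := fun n a => by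
  have : ((∑ t ∈ level n, a t • hY t : spaceY) : L1I) = ∑ t ∈ level n, a t • h t := by
    rw [Submodule.coe_sum]
    rfl
  rw [← isL1Tree_h n a, ← this, Submodule.coe_norm]

theorem dense_span_hY : Dense (Submodule.span ℝ (range hY) : Set spaceY) := by
  intro y
  rw [closure_subtype]
  have himg : (Subtype.val '' (Submodule.span ℝ (range hY) : Set spaceY) : Set L1I) =
      Submodule.span ℝ (range h) := by
    have := Submodule.map_span spaceY.subtype (range hY)
    rw [← range_comp] at this
    exact congrArg SetLike.coe this
  rw [himg, span_range_h]
  exact y.2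

instance : CompleteSpace spaceY :=
  (Submodule.isClosed_topologicalClosure _).completeSpace_coe

theorem nonempty_spaceY_equiv : Nonempty (spaceY ≃ₗᵢ[ℝ] L1I) :=
  nonempty_linearIsometryEquiv isTree_hY isSetTree_setD.isTree isL1Tree_hY isSetTree_setD.isL1Tree
    dense_span_hY dense_span_normInd_setD

theorem isSuperDeltaPoint_spaceY {y : spaceY} (hy : ‖y‖ = 1) : IsSuperDeltaPoint y :=
  isTree_hY.isSuperDeltaPoint isL1Tree_hY dense_span_hY hy

/-- The inclusion of `Y` in `X` as a linear isometry. -/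
def inclusionYX : spaceY →ₗᵢ[ℝ] spaceX where
  toLinearMap := Submodule.inclusion spaceY_le_spaceX
  norm_map' y := by
    rw [Submodule.coe_norm, Submodule.coe_norm]
    exact congrArg norm (Submodule.coe_inclusion spaceY_le_spaceX y)

theorem inclusionYX_apply (y : spaceY) :
    inclusionYX y = Submodule.inclusion spaceY_le_spaceX y := rfl

theorem isSuperDeltaPoint_inclusion {y : spaceY} (hy : ‖y‖ = 1) :
    IsSuperDeltaPoint (Submodule.inclusion spaceY_le_spaceX y) := by
  rw [← inclusionYX_apply]
  exact (isSuperDeltaPoint_spaceY hy).map inclusionYX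

/-! ### Non-reflexivity of `X` -/

/-- In a reflexive space every bounded sequence has a weak cluster point. -/
theorem IsReflexiveSpace.exists_mapClusterPt {E : Type*} [NormedAddCommGroup E] [NormedSpace ℝ E]
    (hE : IsReflexiveSpace E) {x : ℕ → E} (hx : ∀ n, ‖x n‖ ≤ 1) :
    ∃ z : E, ∀ φ : StrongDual ℝ E, MapClusterPt (φ z) atTop fun n => φ (x n) := by
  -- Banach–Alaoglu in the bidual gives a cluster point, which reflexivity brings back to E.
  have hK := WeakDual.isCompact_closedBall (𝕜 := ℝ) (E := StrongDual ℝ E) 0 1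
  obtain ⟨Λ, -, hΛ⟩ := hK.exists_mapClusterPt (f := atTop)
    (u := fun n => StrongDual.toWeakDual (NormedSpace.inclusionInDoubleDual ℝ E (x n)))
    (tendsto_principal.2 (Eventually.of_forall fun n => mem_closedBall_zero_iff.2
      ((NormedSpace.double_dual_bound ℝ E (x n)).trans (hx n))))
  obtain ⟨z, hz⟩ := hE (WeakDual.toStrongDual Λ)
  refine ⟨z, fun φ => ?_⟩
  have := hΛ.continuousAt_comp (f := fun L : WeakDual ℝ (StrongDual ℝ E) => L φ)
    (WeakDual.eval_continuous φ).continuousAt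
  have h2 : Λ φ = φ z := (congrArg (fun L => L φ) hz).symm
  rw [← h2]
  exact this

/-- Along the branch of zeros, a weak cluster point of the `h (t n)` would have integral 1 over each
`setH (t m)`, although these measures tend to 0; this contradicts absolute continuity of the
integral. -/
theorem not_isReflexiveSpace_spaceX : ¬ IsReflexiveSpace spaceX := by
  intro hX
  set t : ℕ → List Bool := fun n => List.replicate n false
  have hsub : ∀ {m n : ℕ}, m ≤ n → setH (t n) ⊆ setH (t m) := by
    intro m n hmn
    induction n, hmn using Nat.le_induction with
    | base => exact subset_rfl
    | succ n hmn ih =>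
      refine subset_trans ?_ ih
      have : t (n + 1) = t n ++ [false] := List.replicate_succ'
      rw [this]
      exact isSetTree_setH.subset_append _ _
  obtain ⟨z, hz⟩ := hX.exists_mapClusterPt (x := fun n => ⟨h (t n), h_mem_spaceX _⟩)
    fun n => (isL1Tree_h.norm_eq_one (t n)).le
  have hone : ∀ m, setInt (setH (t m)) z = 1 := by
    intro m
    have h1 := hz ((setInt (setH (t m))).comp spaceX.subtypeL)
    have h2 : Tendsto (fun n => ((setInt (setH (t m))).comp spaceX.subtypeL)
        (⟨h (t n), h_mem_spaceX _⟩ : spaceX)) atTop (𝓝 1) := by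
      refine tendsto_const_nhds.congr' ?_
      filter_upwards [eventually_ge_atTop m] with n hn
      show 1 = setInt (setH (t m)) (h (t n))
      rw [h_eq, setInt_normInd_of_subset _ (hsub hn) (isSetTree_setH.real_pos _).ne']
    obtain ⟨ψ, hψ, h3⟩ := h1.tendsto_subseq
    exact tendsto_nhds_unique h3 (h2.comp hψ.tendsto_atTop)
  have hmeas : Tendsto (fun m => volI (setH (t m))) atTop (𝓝 0) := by
    have h0 : Tendsto (fun m : ℕ => (1 / 2 : ℝ) ^ (m + 1)) atTop (𝓝 0) :=
      (tendsto_pow_atTop_nhds_zero_of_lt_one (by norm_num) (by norm_num)).comp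
        (tendsto_add_atTop_nat 1)
    have := ENNReal.tendsto_ofReal h0
    rw [ENNReal.ofReal_zero] at this
    refine this.congr fun m => ?_
    rw [← ENNReal.ofReal_toReal (measure_ne_top volI (setH (t m))), ← measureReal_def, real_setH,
      List.length_replicate, one_div_pow]
  have hlim := (L1.integrable_coeFn (z : L1I)).tendsto_setIntegral_nhds_zero hmeas
  have : Tendsto (fun _ : ℕ => (1 : ℝ)) atTop (𝓝 0) := hlim.congr hone
  exact one_ne_zero (tendsto_nhds_unique tendsto_const_nhds this)

/-! ### Structure of the span of the functions `f_t` -/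

/-- Used to get B_{i+1}^t = ½B_i^t and C_i^t = ½ + B_i^t. -/
theorem foldl_half_affine (a b : ℝ) (I : ℝ × ℝ) (t : List Bool) :
    t.foldl half (a * I.1 + b, a * I.2 + b) =
      (a * (t.foldl half I).1 + b, a * (t.foldl half I).2 + b) := by
  induction t using List.reverseRecOn with
  | nil => rfl
  | append_singleton t e ih =>
    rw [foldl_half_append, foldl_half_append, ih]
    cases e <;> simp only [half, Bool.false_eq_true, if_false, if_true, Prod.mk.injEq, true_and,
      and_true] <;> ring

theorem setB_endpoints_half (i : ℕ) (t : List Bool) :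
    t.foldl half (1 / 2 ^ (i + 1 + 1), 1 / 2 ^ (i + 1)) =
      ((t.foldl half (1 / 2 ^ (i + 1), 1 / 2 ^ i)).1 / 2,
        (t.foldl half (1 / 2 ^ (i + 1), 1 / 2 ^ i)).2 / 2) := by
  have := foldl_half_affine (1 / 2) 0 (1 / 2 ^ (i + 1), 1 / 2 ^ i) t
  have h2 : ((1 / 2 ^ (i + 1 + 1), 1 / 2 ^ (i + 1)) : ℝ × ℝ) =
      (1 / 2 * (1 / 2 ^ (i + 1)) + 0, 1 / 2 * (1 / 2 ^ i) + 0) := by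
    ext <;> simp only [pow_succ] <;> field_simp <;> ring
  rw [h2, this]
  ext <;> simp only <;> ring

theorem setC_endpoints (i : ℕ) (t : List Bool) :
    t.foldl half (1 / 2 + 1 / 2 ^ (i + 1), 1 / 2 + 1 / 2 ^ i) =
      ((t.foldl half (1 / 2 ^ (i + 1), 1 / 2 ^ i)).1 + 1 / 2,
        (t.foldl half (1 / 2 ^ (i + 1), 1 / 2 ^ i)).2 + 1 / 2) := by
  have := foldl_half_affine 1 (1 / 2) (1 / 2 ^ (i + 1), 1 / 2 ^ i) t
  simp only [one_mul] at this
  rw [← this, add_comm (1 / 2 : ℝ), add_comm (1 / 2 : ℝ)]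

theorem half_mem_setB_iff {i : ℕ} {t : List Bool} {x : ℝ} :
    x / 2 ∈ setB (i + 1) t ↔ x ∈ setB i t := by
  simp only [setB, subInterval, setB_endpoints_half, mem_Ico]
  constructor <;> rintro ⟨h1, h2⟩ <;> constructor <;> linarith

theorem add_half_mem_setC_iff {i : ℕ} {t : List Bool} {x : ℝ} :
    x + 1 / 2 ∈ setC i t ↔ x ∈ setB i t := by
  simp only [setB, setC, subInterval, setC_endpoints, mem_Ico]
  constructor <;> rintro ⟨h1, h2⟩ <;> constructor <;> linarith

theorem setB_subset_nil (i : ℕ) (t : List Bool) : setB i t ⊆ setB i [] := setB_subset i t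

theorem setC_subset_nil (i : ℕ) (t : List Bool) : setC i t ⊆ setC i [] := setC_subset i t

theorem fFun_of_mem_setB {i : ℕ} (hi : 1 ≤ i) (s : List Bool) {x : ℝ} (hx : x ∈ setB i []) :
    fFun s x = 2 ^ (s.length + 1) * if i ≤ s.length then (setB i s).indicator 1 x else 0 := by
  rw [fFun, indicator_of_notMem fun h => (setC_disjoint_setB hi s []).ne_of_mem h hx rfl, zero_add]
  have hne : ∀ j, j ≠ i → (setB j s).indicator (1 : ℝ → ℝ) x = 0 := fun j hj =>
    indicator_of_notMem (fun h => (setB_disjoint hj s []).ne_of_mem h hx rfl) _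
  congr 1
  split_ifs with h
  · exact Finset.sum_eq_single i (fun j _ hj => hne j hj)
      fun h' => absurd (Finset.mem_Icc.2 ⟨hi, h⟩) h'
  · refine Finset.sum_eq_zero fun j hj => hne j ?_
    rintro rfl
    exact h (Finset.mem_Icc.1 hj).2

theorem fFun_of_mem_setC {i : ℕ} (s : List Bool) {x : ℝ} (hx : x ∈ setC i []) :
    fFun s x = 2 ^ (s.length + 1) * if s.length = i then (setC i s).indicator 1 x else 0 := by
  rw [fFun, Finset.sum_eq_zero fun j hj => indicator_of_notMem (fun h =>
    (setC_disjoint_setB (Finset.mem_Icc.1 hj).1 [] s).ne_of_mem hx h rfl) _, add_zero]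
  congr 1
  split_ifs with h
  · rw [h]
  · exact indicator_of_notMem (fun h' => (setC_disjoint h s []).ne_of_mem h' hx rfl) _

/-- The linear span of the functions `f_t`. -/
def spanF : Submodule ℝ (ℝ → ℝ) := Submodule.span ℝ (fFun '' tree)

theorem setF_subset_Icc {k : ℕ} (hk : 1 ≤ k) (t : List Bool) : setF k t ⊆ Icc 0 1 := by
  rintro x (hx | hx)
  · have h1 := half_lt_of_mem_setC hx
    have h2 := (setC_subset _ _ hx).2
    have h3 := one_div_two_pow_le hk
    rw [pow_one] at h3
    exact ⟨by linarith, by linarith⟩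
  · simp only [mem_iUnion] at hx
    obtain ⟨i, hi, hx⟩ := hx
    have h1 := (setB_subset _ _ hx).1
    have h2 := lt_half_of_mem_setB (Finset.mem_Icc.1 hi).1 hx
    have h3 : (0 : ℝ) < 1 / 2 ^ (i + 1) := by positivity
    exact ⟨by linarith, by linarith⟩

theorem integrable_of_mem_spanF {g : ℝ → ℝ} (hg : g ∈ spanF) : Integrable g := by
  induction hg using Submodule.span_induction with
  | mem g hg =>
    obtain ⟨s, hs, rfl⟩ := hg
    have hlen : 1 ≤ s.length := List.length_pos_iff.2 hs
    have : fFun s = fun x => (volI.real (setF s.length s))⁻¹ *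
        (setF s.length s).indicator 1 x := funext (fFun_eq hs)
    rw [this]
    refine Integrable.const_mul ?_ _
    refine (integrable_indicator_iff ((isSetTree_setF hlen).measurableSet s)).2 ?_
    refine integrableOn_const (C := (1 : ℝ)) ?_
    exact ((measure_mono (setF_subset_Icc hlen s)).trans_lt (by simp)).ne
  | zero => exact integrable_zero _ _ _
  | add g k _ _ hg hk => exact hg.add hk
  | smul c g _ hg => exact hg.smul c

/-- The relation is linear in g. For a generator f_s it holds because x/2 carries the value when i <
|s|, x + 1/2 carries it when i = |s|, and everything vanishes when i > |s|. -/
theorem eq_add_of_mem_spanF {g : ℝ → ℝ} (hg : g ∈ spanF) {i : ℕ} (hi : 1 ≤ i) {x : ℝ}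
    (hx : x ∈ setB i []) : g x = g (x + 1 / 2) + g (x / 2) := by
  induction hg using Submodule.span_induction with
  | mem g hg =>
    obtain ⟨s, -, rfl⟩ := hg
    rw [fFun_of_mem_setB hi s hx, fFun_of_mem_setC s (add_half_mem_setC_iff.2 hx),
      fFun_of_mem_setB (by omega : 1 ≤ i + 1) s (half_mem_setB_iff.2 hx)]
    have e1 : (setB (i + 1) s).indicator (1 : ℝ → ℝ) (x / 2) = (setB i s).indicator 1 x :=
      indicator_eq_indicator half_mem_setB_iff rfl
    have e2 : (setC i s).indicator (1 : ℝ → ℝ) (x + 1 / 2) = (setB i s).indicator 1 x :=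
      indicator_eq_indicator add_half_mem_setC_iff rfl
    rw [e1, e2, ← mul_add]
    congr 1
    rcases lt_trichotomy i s.length with h | h | h
    · rw [if_pos h.le, if_neg h.ne', if_pos (by omega), zero_add]
    · rw [if_pos h.le, if_pos h.symm, if_neg (by omega), add_zero]
    · rw [if_neg h.not_ge, if_neg h.ne, if_neg (by omega), zero_add]
  | zero => simp
  | add g k _ _ hg hk => simp only [Pi.add_apply, hg, hk]; ring
  | smul c g _ hg => simp only [Pi.smul_apply, smul_eq_mul, hg]; ring

theorem eq_of_mem_setC {g : ℝ → ℝ} (hg : g ∈ spanF) {t : List Bool} (ht : t ≠ []) {x y : ℝ}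
    (hx : x ∈ setC t.length t) (hy : y ∈ setC t.length t) : g x = g y := by
  induction hg using Submodule.span_induction with
  | mem g hg =>
    obtain ⟨s, -, rfl⟩ := hg
    rw [fFun_of_mem_setC s (setC_subset_nil _ _ hx), fFun_of_mem_setC s (setC_subset_nil _ _ hy)]
    congr 1
    split_ifs with h
    · by_cases hst : s = t
      · subst hst
        rw [indicator_of_mem hx, indicator_of_mem hy]
        rfl
      · have hd := ((isSetTree_setF (List.length_pos_iff.2 ht)).disjoint_level (mem_level.2 h)
          (mem_level.2 rfl) hst).mono (a := setC t.length s) (c := setC t.length t)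
          subset_union_left subset_union_left
        rw [indicator_of_notMem fun h => hd.ne_of_mem h hx rfl,
          indicator_of_notMem fun h => hd.ne_of_mem h hy rfl]
    · rfl
  | zero => simp
  | add g k _ _ hg hk => simp only [Pi.add_apply, hg, hk]
  | smul c g _ hg => simp only [Pi.smul_apply, hg]

theorem exists_mem_spanF {x : L1I} (hx : x ∈ Submodule.span ℝ (f '' tree)) :
    ∃ g ∈ spanF, x =ᵐ[volI] g := by
  induction hx using Submodule.span_induction with
  | mem x hx =>
    obtain ⟨s, hs, rfl⟩ := hx
    exact ⟨fFun s, Submodule.subset_span ⟨s, hs, rfl⟩, (memLp_fFun s).coeFn_toLp⟩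
  | zero => exact ⟨0, Submodule.zero_mem _, Lp.coeFn_zero _ _ _⟩
  | add x y _ _ hx hy =>
    obtain ⟨g, hg, hxg⟩ := hx
    obtain ⟨k, hk, hyk⟩ := hy
    exact ⟨g + k, Submodule.add_mem _ hg hk, (Lp.coeFn_add x y).trans (hxg.add hyk)⟩
  | smul c x _ hx =>
    obtain ⟨g, hg, hxg⟩ := hx
    exact ⟨c • g, Submodule.smul_mem _ c hg, (Lp.coeFn_smul c x).trans (hxg.const_smul c)⟩

/-! ### Integral estimates -/

theorem measurableSet_setB (i : ℕ) (t : List Bool) : MeasurableSet (setB i t) :=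
  measurableSet_subInterval _ _

theorem measurableSet_setC (i : ℕ) (t : List Bool) : MeasurableSet (setC i t) :=
  measurableSet_subInterval _ _

theorem setIntegral_subInterval {I : ℝ × ℝ} (hI : I.1 ≤ I.2) (t : List Bool) (u : ℝ → ℝ) :
    ∫ x in subInterval I t, u x = ∫ x in (t.foldl half I).1..(t.foldl half I).2, u x := by
  rw [intervalIntegral.integral_of_le (foldl_half_le hI t), subInterval,
    integral_Ico_eq_integral_Ioc]

theorem setIntegral_setB (i : ℕ) (t : List Bool) (u : ℝ → ℝ) :
    ∫ x in setB i t, u x = ∫ x in (t.foldl half (1 / 2 ^ (i + 1), 1 / 2 ^ i)).1..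
      (t.foldl half (1 / 2 ^ (i + 1), 1 / 2 ^ i)).2, u x :=
  setIntegral_subInterval (one_div_two_pow_succ_lt i).le t u

theorem setIntegral_setB_comp_half (i : ℕ) (t : List Bool) (u : ℝ → ℝ) :
    ∫ x in setB i t, u (x / 2) = 2 * ∫ x in setB (i + 1) t, u x := by
  rw [setIntegral_setB, setIntegral_setB, setB_endpoints_half,
    intervalIntegral.integral_comp_div u two_ne_zero, smul_eq_mul]

theorem setIntegral_setB_comp_add (i : ℕ) (t : List Bool) (u : ℝ → ℝ) :
    ∫ x in setB i t, u (x + 1 / 2) = ∫ x in setC i t, u x := by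
  have h := one_div_two_pow_succ_lt i
  rw [setIntegral_setB, setC, setIntegral_subInterval (by simp only; linarith), setC_endpoints,
    intervalIntegral.integral_comp_add_right]

theorem setB_subset_Icc {i : ℕ} (hi : 1 ≤ i) (t : List Bool) : setB i t ⊆ Icc 0 1 := by
  intro x hx
  have h1 := (setB_subset _ _ hx).1
  have h2 := lt_half_of_mem_setB hi hx
  have h3 : (0 : ℝ) < 1 / 2 ^ (i + 1) := by positivity
  exact ⟨by linarith, by linarith⟩

theorem setC_subset_Icc {i : ℕ} (hi : 1 ≤ i) (t : List Bool) : setC i t ⊆ Icc 0 1 :=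
  subset_union_left.trans (setF_subset_Icc hi t)

theorem restrict_volI {A : Set ℝ} (hA : MeasurableSet A) (hsub : A ⊆ Icc 0 1) :
    volI.restrict A = volume.restrict A := by
  rw [Measure.restrict_restrict hA, inter_eq_self_of_subset_left hsub]

theorem setIntegral_abs_le_compl {g : ℝ → ℝ} (hg : Integrable g) {A S : Set ℝ}
    (hA : MeasurableSet A) (hsub : A ⊆ Icc 0 1) (hS : Disjoint A S) :
    ∫ x in A, |g x| ≤ ∫ x in Sᶜ, |g x| ∂volI := by
  rw [← restrict_volI hA hsub]
  exact setIntegral_mono_set (hg.abs.mono_measure Measure.restrict_le_self).integrableOn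
    (Eventually.of_forall fun x => abs_nonneg _) hS.subset_compl_right.eventuallyLE

/-- Descending induction on the block index i = |t| - d, driven by `eq_add_of_mem_spanF`; K depends
on t and d but not on g. -/
theorem exists_setIntegral_setB_le {t : List Bool} (d : ℕ) (hd : d < t.length) :
    ∃ K : ℝ, ∀ g ∈ spanF, ∀ c : ℝ, (∀ x ∈ setC t.length t, g x = c) →
      ∫ x in setB (t.length - d) t, |g x - c| ≤
        K * ∫ x in (setF t.length t)ᶜ, |g x| ∂volI := by
  set n := t.length with hn
  set S := setF n t with hS
  have hne : t ≠ [] := by rintro rfl; simp at hn; omega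
  have hdisjF : ∀ A : Set ℝ, Disjoint A (setC n t) →
      (∀ i ∈ Finset.Icc 1 n, Disjoint A (setB i t)) → Disjoint A S := by
    intro A h1 h2
    simp only [hS, setF, disjoint_union_right, disjoint_iUnion_right]
    exact ⟨h1, h2⟩
  induction d with
  | zero =>
    -- On B_n^t the relation reads g(x) - c = g(x/2), with x/2 in B_{n+1}^t, off the support; 2 is
    -- the Jacobian.
    refine ⟨2, fun g hg c hc => ?_⟩
    have hgi := integrable_of_mem_spanF hg
    have : ∫ x in setB n t, |g x - c| = ∫ x in setB n t, |g (x / 2)| := by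
      refine setIntegral_congr_fun (measurableSet_setB _ _) fun x hx => ?_
      rw [eq_add_of_mem_spanF hg (by omega : 1 ≤ n) (setB_subset_nil _ _ hx),
        hc _ (add_half_mem_setC_iff.2 hx), add_sub_cancel_left]
    rw [Nat.sub_zero, this, setIntegral_setB_comp_half n t fun x => |g x|]
    refine mul_le_mul_of_nonneg_left ?_ zero_le_two
    refine setIntegral_abs_le_compl hgi (measurableSet_setB _ _)
      (setB_subset_Icc (by omega) t) (hdisjF _ (setC_disjoint_setB (by omega) t t).symm ?_)
    intro i hi
    have := (Finset.mem_Icc.1 hi).2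
    exact setB_disjoint (by omega) t t
  | succ d ih =>
    obtain ⟨K, hK⟩ := ih (by omega)
    -- Here g(x) - c = g(x+1/2) + (g(x/2) - c): the first term lives on C_i^t, off the support as i
    -- < n, and the second is the previous block, with Jacobian 2.
    refine ⟨1 + 2 * K, fun g hg c hc => ?_⟩
    have hgi := integrable_of_mem_spanF hg
    set i := n - (d + 1) with hi
    have hi1 : 1 ≤ i := by omega
    have hK' := hK g hg c hc
    rw [show n - d = i + 1 by omega] at hK'
    have hfin : volume (setB i t) ≠ ∞ :=
      ((measure_mono (setB_subset_Icc hi1 t)).trans_lt (by simp)).ne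
    have h1 : IntegrableOn (fun x => |g (x + 1 / 2)|) (setB i t) :=
      (hgi.comp_add_right (1 / 2)).abs.integrableOn
    have h2 : IntegrableOn (fun x => |g (x / 2) - c|) (setB i t) :=
      (((hgi.comp_div two_ne_zero).integrableOn).sub (integrableOn_const hfin)).abs
    have h3 : ∫ x in setB i t, |g x - c| ≤
        ∫ x in setB i t, (|g (x + 1 / 2)| + |g (x / 2) - c|) := by
      refine setIntegral_mono_on ((hgi.integrableOn).sub (integrableOn_const hfin)).abs
        (h1.add h2) (measurableSet_setB _ _) fun x hx => ?_
      rw [eq_add_of_mem_spanF hg hi1 (setB_subset_nil _ _ hx), add_sub_assoc]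
      exact abs_add_le _ _
    rw [integral_add h1 h2, setIntegral_setB_comp_half i t fun x => |g x - c|,
      setIntegral_setB_comp_add i t fun x => |g x|] at h3
    have h4 : ∫ x in setC i t, |g x| ≤ ∫ x in Sᶜ, |g x| ∂volI := by
      refine setIntegral_abs_le_compl hgi (measurableSet_setC _ _) (setC_subset_Icc hi1 t)
        (hdisjF _ (setC_disjoint (by omega) t t) fun j hj => ?_)
      exact setC_disjoint_setB (Finset.mem_Icc.1 hj).1 t t
    linarith

theorem exists_setIntegral_setF_le {t : List Bool} (ht : t ≠ []) :
    ∃ K : ℝ, ∀ g ∈ spanF, ∃ c : ℝ, ∫ x in setF t.length t, |g x - c| ∂volI ≤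
      K * ∫ x in (setF t.length t)ᶜ, |g x| ∂volI := by
  have hn : 1 ≤ t.length := List.length_pos_iff.2 ht
  choose! K hK using fun d => exists_setIntegral_setB_le (t := t) d
  refine ⟨∑ i ∈ Finset.Icc 1 t.length, K (t.length - i), fun g hg => ?_⟩
  have hgi := integrable_of_mem_spanF hg
  obtain ⟨c, hc⟩ : ∃ c, ∀ x ∈ setC t.length t, g x = c := by
    by_cases h : (setC t.length t).Nonempty
    · obtain ⟨y, hy⟩ := h
      exact ⟨g y, fun x hx => eq_of_mem_setC hg ht hx hy⟩
    · exact ⟨0, fun x hx => absurd ⟨x, hx⟩ h⟩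
  refine ⟨c, ?_⟩
  have hSm := (isSetTree_setF hn).measurableSet t
  rw [restrict_volI hSm (setF_subset_Icc hn t)]
  have hfin : volume (setF t.length t) ≠ ∞ :=
    ((measure_mono (setF_subset_Icc hn t)).trans_lt (by simp)).ne
  have hint : IntegrableOn (fun x => |g x - c|) (setF t.length t) :=
    ((hgi.integrableOn).sub (integrableOn_const hfin)).abs
  have hdisj : Disjoint (setC t.length t) (⋃ i ∈ Finset.Icc 1 t.length, setB i t) := by
    simp only [disjoint_iUnion_right]
    exact fun i hi => setC_disjoint_setB (Finset.mem_Icc.1 hi).1 _ _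
  have hm : MeasurableSet (⋃ i ∈ Finset.Icc 1 t.length, setB i t) :=
    Finset.measurableSet_biUnion _ fun i _ => measurableSet_setB _ _
  have hzero : ∫ x in setC t.length t, |g x - c| = 0 := by
    rw [setIntegral_congr_fun (g := fun _ => (0 : ℝ)) (measurableSet_setC _ _)
      fun x hx => by simp [hc x hx]]
    simp
  rw [setF, setIntegral_union hdisj hm (hint.mono_set subset_union_left)
    (hint.mono_set subset_union_right), hzero, zero_add,
    integral_biUnion_finset _ (fun i _ => measurableSet_setB _ _)
      (fun i _ j _ hij => setB_disjoint hij _ _)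
      (fun i hi => hint.mono_set ((subset_biUnion_of_mem (u := fun i => setB i t) hi).trans
        subset_union_right)), Finset.sum_mul]
  refine Finset.sum_le_sum fun i hi => ?_
  have := Finset.mem_Icc.1 hi
  have h := hK (t.length - i) (by omega) g hg c hc
  rwa [show t.length - (t.length - i) = i by omega] at h

/-! ### The vectors `f_t` are strongly exposed in `X` -/

/-- Compare x first with c·1_S; replacing c by the mean of x over S costs the second copy of the
integral over S. -/
theorem norm_sub_setInt_smul_le {S : Set ℝ} (hS : MeasurableSet S) (h0 : volI.real S ≠ 0) (x : L1I)
    (c : ℝ) : ‖x - setInt S x • normInd S hS‖ ≤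
      ∫ a in Sᶜ, |x a| ∂volI + 2 * ∫ a in S, |x a - c| ∂volI := by
  have hx := L1.integrable_coeFn x
  have hxc : IntegrableOn (fun a => x a - c) S volI :=
    hx.integrableOn.sub (integrableOn_const (measure_ne_top _ _))
  have h1 : ‖x - (c * volI.real S) • normInd S hS‖ =
      ∫ a in Sᶜ, |x a| ∂volI + ∫ a in S, |x a - c| ∂volI := by
    have hae : (x - (c * volI.real S) • normInd S hS : L1I) =ᵐ[volI]
        fun a => x a - c * S.indicator 1 a := by
      filter_upwards [Lp.coeFn_sub x ((c * volI.real S) • normInd S hS),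
        Lp.coeFn_smul (c * volI.real S) (normInd S hS), coeFn_normInd S hS] with a h1 h2 h3
      rw [h1, Pi.sub_apply, h2, Pi.smul_apply, h3, smul_eq_mul]
      field_simp
    rw [L1.norm_eq_integral_norm, integral_congr_ae (hae.mono fun a ha => congrArg norm ha),
      ← integral_add_compl hS, add_comm]
    · congr 1
      · refine setIntegral_congr_fun hS.compl fun a ha => ?_
        simp only [indicator_of_notMem ha, mul_zero, sub_zero, Real.norm_eq_abs]
      · refine setIntegral_congr_fun hS fun a ha => ?_
        simp only [indicator_of_mem ha, Pi.one_apply, mul_one, Real.norm_eq_abs]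
    · exact (hx.sub (((integrable_const (1 : ℝ)).indicator hS).const_mul c)).norm
  have h2 : ‖(c * volI.real S) • normInd S hS - setInt S x • normInd S hS‖ ≤
      ∫ a in S, |x a - c| ∂volI := by
    rw [← sub_smul, norm_smul, norm_normInd hS h0, mul_one, norm_sub_rev, setInt_apply]
    have : ∫ a in S, x a ∂volI - c * volI.real S = ∫ a in S, (x a - c) ∂volI := by
      rw [integral_sub hx.integrableOn (integrableOn_const (measure_ne_top _ _)),
        setIntegral_const, smul_eq_mul, mul_comm]
    rw [this]
    exact norm_integral_le_integral_norm _
  have h3 := norm_add_le (x - (c * volI.real S) • normInd S hS)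
    ((c * volI.real S) • normInd S hS - setInt S x • normInd S hS)
  rw [sub_add_sub_cancel] at h3
  linarith

theorem setIntegral_compl_le {S : Set ℝ} (hS : MeasurableSet S) (x : L1I) :
    ∫ a in Sᶜ, |x a| ∂volI ≤ ‖x‖ - setInt S x := by
  have h1 := integral_add_compl hS (L1.integrable_coeFn x).abs
  have h2 : ‖x‖ = ∫ a, |x a| ∂volI := L1.norm_eq_integral_norm x
  have h3 := (le_abs_self _).trans (abs_setInt_le_setIntegral S x)
  linarith

/-- Strong exposure in quantitative form: if the integral over the support nearly attains the norm,
little mass lies off the support, so x is nearly a multiple of f_t. -/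
theorem exists_norm_sub_setInt_smul_f_le {t : List Bool} (ht : t ≠ []) :
    ∃ K : ℝ, 0 ≤ K ∧ ∀ x ∈ spaceX, ‖x - setInt (setF t.length t) x • f t‖ ≤
      K * (‖x‖ - setInt (setF t.length t) x) := by
  have hn : 1 ≤ t.length := List.length_pos_iff.2 ht
  have hSm := (isSetTree_setF hn).measurableSet t
  obtain ⟨K, hK⟩ := exists_setIntegral_setF_le ht
  refine ⟨1 + 2 * |K|, by positivity, fun x hx => ?_⟩
  -- The inequality is a closed condition on x, so it suffices to treat the algebraic span, where
  -- the pointwise relations are available.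
  refine closure_minimal (s := (Submodule.span ℝ (f '' tree) : Set L1I)) (t := {x : L1I |
    ‖x - setInt (setF t.length t) x • f t‖ ≤
      (1 + 2 * |K|) * (‖x‖ - setInt (setF t.length t) x)}) ?_
    (isClosed_le (by fun_prop) (by fun_prop)) hx
  intro x hx
  obtain ⟨g, hg, hxg⟩ := exists_mem_spanF hx
  obtain ⟨c, hc⟩ := hK g hg
  have h1 := norm_sub_setInt_smul_le hSm ((isSetTree_setF hn).real_pos t).ne' x c
  have e1 : ∫ a in setF t.length t, |x a - c| ∂volI =
      ∫ a in setF t.length t, |g a - c| ∂volI :=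
    integral_congr_ae (ae_restrict_of_ae (hxg.mono fun a ha => by simp only [ha]))
  have e2 : ∫ a in (setF t.length t)ᶜ, |x a| ∂volI = ∫ a in (setF t.length t)ᶜ, |g a| ∂volI :=
    integral_congr_ae (ae_restrict_of_ae (hxg.mono fun a ha => by simp only [ha]))
  rw [← f_eq ht, e1, e2] at h1
  have h2 := setIntegral_compl_le hSm x
  rw [e2] at h2
  have h3 : 0 ≤ ∫ a in (setF t.length t)ᶜ, |g a| ∂volI :=
    integral_nonneg fun a => abs_nonneg _
  have h4 := mul_le_mul_of_nonneg_right (le_abs_self K) h3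
  rw [mem_ofPred_eq]
  calc ‖x - setInt (setF t.length t) x • f t‖
      ≤ (1 + 2 * |K|) * ∫ a in (setF t.length t)ᶜ, |g a| ∂volI := by linarith
    _ ≤ _ := mul_le_mul_of_nonneg_left h2 (by positivity)

/-! ### Small slices around `f_t` -/

/-- The vectors `f_t` as elements of `X`. -/
def fX (t : List Bool) (ht : t ≠ []) : spaceX := ⟨f t, f_mem_spaceX ht⟩

theorem coe_fX (t : List Bool) (ht : t ≠ []) : (fX t ht : L1I) = f t := rfl

/-- Integration over the support of `f_t`, as a functional on `X`. -/
def exposing (t : List Bool) : StrongDual ℝ spaceX :=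
  (setInt (setF t.length t)).comp spaceX.subtypeL

theorem exposing_apply (t : List Bool) (x : spaceX) :
    exposing t x = setInt (setF t.length t) x := rfl

theorem abs_exposing_le (t : List Bool) (x : spaceX) : |exposing t x| ≤ ‖x‖ :=
  abs_setInt_le _ _

theorem exposing_fX {t : List Bool} (ht : t ≠ []) : exposing t (fX t ht) = 1 := by
  rw [exposing_apply, coe_fX, f_eq ht]
  exact setInt_normInd_of_subset _ subset_rfl
    ((isSetTree_setF (List.length_pos_iff.2 ht)).real_pos t).ne'

theorem norm_fX {t : List Bool} (ht : t ≠ []) : ‖fX t ht‖ = 1 := by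
  rw [Submodule.coe_norm, coe_fX, f_eq ht]
  exact norm_normInd _ ((isSetTree_setF (List.length_pos_iff.2 ht)).real_pos t).ne'

theorem sSup_image_closedBall_le {E : Type*} [NormedAddCommGroup E] [NormedSpace ℝ E]
    {φ : StrongDual ℝ E} (hφ : ∀ x, |φ x| ≤ ‖x‖) :
    sSup (φ '' Metric.closedBall (0 : E) 1) ≤ 1 := by
  refine csSup_le ⟨_, 0, by simp, rfl⟩ ?_
  rintro _ ⟨x, hx, rfl⟩
  exact (le_abs_self _).trans ((hφ x).trans (by simpa using hx))

theorem exists_slice_subset {t : List Bool} (ht : t ≠ []) {σ : ℝ} (hσ : |σ| = 1) {δ : ℝ}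
    (hδ : 0 < δ) : ∃ β > 0, ∀ z ∈ slice (σ • exposing t) β, ‖z - σ • fX t ht‖ ≤ δ := by
  have hσσ : σ * σ = 1 := by rw [← abs_mul_abs_self, hσ, one_mul]
  obtain ⟨K, hK0, hK⟩ := exists_norm_sub_setInt_smul_f_le ht
  -- The error splits into Kβ, for the distance from σz to q·f_t, and β, for 1 - q.
  refine ⟨δ / (K + 1), by positivity, ?_⟩
  rintro z ⟨hz, hzs⟩
  have hz1 : ‖z‖ ≤ 1 := by simpa using hz
  have hbound : ∀ x, |(σ • exposing t) x| ≤ ‖x‖ := fun x => by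
    rw [_root_.smul_apply, smul_eq_mul, abs_mul, hσ, one_mul]
    exact abs_exposing_le t x
  have hsup : 1 ≤ sSup ((σ • exposing t) '' Metric.closedBall (0 : spaceX) 1) := by
    refine le_csSup ⟨1, ?_⟩ ⟨σ • fX t ht, ?_, ?_⟩
    · rintro _ ⟨x, hx, rfl⟩
      exact (le_abs_self _).trans ((hbound x).trans (by simpa using hx))
    · rw [mem_closedBall_zero_iff, norm_smul, norm_fX, Real.norm_eq_abs, hσ, one_mul]
    · rw [_root_.smul_apply, map_smul, exposing_fX, smul_eq_mul, smul_eq_mul, mul_one,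
        hσσ]
  have hw := hK (σ • z : spaceX) (σ • z : spaceX).2
  have hnorm : ‖((σ • z : spaceX) : L1I)‖ ≤ 1 := by
    rw [← Submodule.coe_norm, norm_smul, Real.norm_eq_abs, hσ, one_mul]
    exact hz1
  set q := exposing t (σ • z) with hq
  have hqs : (σ • exposing t) z = q := by
    rw [hq, map_smul, _root_.smul_apply]
  rw [hqs] at hzs
  have hq1 : q ≤ 1 := (le_abs_self _).trans ((abs_exposing_le t _).trans hnorm)
  have e1 : ‖σ • z - q • fX t ht‖ ≤ K * (δ / (K + 1)) := by
    refine hw.trans (mul_le_mul_of_nonneg_left ?_ hK0)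
    rw [← exposing_apply, ← hq]
    linarith
  have e2 : ‖q • fX t ht - fX t ht‖ ≤ δ / (K + 1) := by
    have : q • fX t ht - fX t ht = (q - 1) • fX t ht := by rw [sub_smul, one_smul]
    rw [this, norm_smul, norm_fX, mul_one, Real.norm_eq_abs, abs_sub_comm, abs_of_nonneg]
    · linarith
    · linarith
  have e3 : z - σ • fX t ht = σ • ((σ • z - q • fX t ht) + (q • fX t ht - fX t ht)) := by
    rw [sub_add_sub_cancel, smul_sub, smul_smul, hσσ, one_smul]
  rw [e3, norm_smul, Real.norm_eq_abs, hσ, one_mul]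
  refine (norm_add_le _ _).trans ((add_le_add e1 e2).trans (le_of_eq ?_))
  field_simp

/-- A slice containing f_t within distance 1 of f_t already excludes a Δ-point. -/
theorem not_hasDLD2P_spaceX : ¬ HasDLD2P spaceX := by
  intro hX
  have ht : [true] ≠ [] := by simp
  obtain ⟨β, hβ, hs⟩ := exists_slice_subset ht (σ := 1) (by simp) one_pos
  simp only [one_smul] at hs
  have hmem : fX [true] ht ∈ slice (exposing [true]) β := by
    refine ⟨mem_closedBall_zero_iff.2 (norm_fX ht).le, ?_⟩
    rw [exposing_fX]
    linarith [sSup_image_closedBall_le (abs_exposing_le [true])]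
  have h := (hX _ (norm_fX ht)).2 _ β hβ hmem
  have h2 : (2 : ℝ) ≤ 1 := h.2 (by
    rintro _ ⟨z, hz, rfl⟩
    show ‖_ - z‖ ≤ 1
    rw [norm_sub_rev]
    exact hs z hz)
  norm_num at h2

/-! ### Approximation by the levels of `X` -/

/-- The projection `x ↦ ∑_{|s| = k} (∫_{supp f_s} x) f_s`. -/
def projF (k : ℕ) : L1I →L[ℝ] L1I :=
  ∑ s ∈ level k, (setInt (setF k s)).smulRight (f s)

theorem projF_apply (k : ℕ) (x : L1I) :
    projF k x = ∑ s ∈ level k, setInt (setF k s) x • f s := by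
  simp [projF]

theorem f_eq_of_mem_level {k : ℕ} (hk : 1 ≤ k) {t : List Bool} (ht : t ∈ level k) :
    f t = normInd (setF k t) ((isSetTree_setF hk).measurableSet t) := by
  obtain rfl := mem_level.1 ht
  exact f_eq (List.length_pos_iff.1 hk)

theorem sum_abs_setInt_setF_le {k : ℕ} (hk : 1 ≤ k) (x : L1I) :
    ∑ s ∈ level k, |setInt (setF k s) x| ≤ ‖x‖ :=
  sum_abs_setInt_le _ _ (fun s _ => (isSetTree_setF hk).measurableSet s)
    ((isSetTree_setF hk).pairwiseDisjoint_level k) x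

theorem norm_projF_le {k : ℕ} (hk : 1 ≤ k) (x : L1I) : ‖projF k x‖ ≤ ‖x‖ := by
  rw [projF_apply]
  refine (norm_sum_le _ _).trans (le_trans (Finset.sum_le_sum fun s hs => ?_)
    (sum_abs_setInt_setF_le hk x))
  rw [norm_smul, f_eq_of_mem_level hk hs, norm_normInd _ ((isSetTree_setF hk).real_pos s).ne',
    mul_one, Real.norm_eq_abs]

theorem projF_eq_self {k : ℕ} (hk : 1 ≤ k) {x : L1I}
    (hx : x ∈ Submodule.span ℝ (f '' (level k : Set (List Bool)))) : projF k x = x := by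
  induction hx using Submodule.span_induction with
  | mem x hx =>
    obtain ⟨t, ht, rfl⟩ := hx
    rw [projF_apply, Finset.sum_eq_single t]
    · rw [f_eq_of_mem_level hk ht, (isSetTree_setF hk).setInt_normInd_level ht ht, if_pos rfl,
        one_smul]
    · intro s hs hst
      rw [f_eq_of_mem_level hk ht, (isSetTree_setF hk).setInt_normInd_level hs ht, if_neg hst,
        zero_smul]
    · exact fun h => absurd ht h
  | zero => simp
  | add x y _ _ hx hy => rw [map_add, hx, hy]
  | smul c x _ hx => rw [map_smul, hx]

/-- `projF (k + 1)` is a contraction fixing the approximant of `h t` at that level, so the error at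
most doubles. -/
theorem tendsto_projF_h (t : List Bool) :
    Tendsto (fun k => projF (k + 1) (h t)) atTop (𝓝 (h t)) := by
  have hlim := tendsto_normInd_setF t
  have h1 := (tendsto_iff_norm_sub_tendsto_zero.1 hlim).const_mul 2
  rw [mul_zero] at h1
  rw [tendsto_iff_norm_sub_tendsto_zero]
  refine squeeze_zero' (Eventually.of_forall fun _ => norm_nonneg _) ?_ h1
  filter_upwards [eventually_ge_atTop t.length] with k hk
  have hk1 : 1 ≤ k + 1 := Nat.le_add_left 1 k
  have hself := projF_eq_self hk1 (normInd_setF_mem_span hk1 t (by omega))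
  set w := normInd (setF (k + 1) t) ((isSetTree_setF hk1).measurableSet t)
  have e : projF (k + 1) (h t) - h t = (w - h t) - projF (k + 1) (w - h t) := by
    rw [map_sub, hself]
    abel
  rw [e]
  have := norm_sub_le (w - h t) (projF (k + 1) (w - h t))
  have := norm_projF_le hk1 (w - h t)
  linarith

theorem tendsto_projF {y : L1I} (hy : y ∈ spaceY) :
    Tendsto (fun k => projF (k + 1) y) atTop (𝓝 y) := by
  have hspan : ∀ y ∈ Submodule.span ℝ (h '' tree),
      Tendsto (fun k => projF (k + 1) y) atTop (𝓝 y) := by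
    intro y hy
    induction hy using Submodule.span_induction with
    | mem y hy =>
      obtain ⟨t, -, rfl⟩ := hy
      exact tendsto_projF_h t
    | zero => simp
    | add x y _ _ hx hy =>
      simp only [map_add]
      exact hx.add hy
    | smul c x _ hx =>
      simp only [map_smul]
      exact hx.const_smul c
  rw [Metric.tendsto_atTop]
  intro ε hε
  obtain ⟨x, hx, hyx⟩ := Metric.mem_closure_iff.1 hy (ε / 3) (by linarith)
  obtain ⟨N, hN⟩ := Metric.tendsto_atTop.1 (hspan x hx) (ε / 3) (by linarith)
  refine ⟨N, fun k hk => ?_⟩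
  have h1 := hN k hk
  have h2 := norm_projF_le (Nat.le_add_left 1 k) (y - x)
  rw [dist_eq_norm] at hyx h1 ⊢
  have e : projF (k + 1) y - y = projF (k + 1) (y - x) + (projF (k + 1) x - x) - (y - x) := by
    rw [map_sub]
    abel
  rw [e]
  have h3 := norm_sub_le (projF (k + 1) (y - x) + (projF (k + 1) x - x)) (y - x)
  have h4 := norm_add_le (projF (k + 1) (y - x)) (projF (k + 1) x - x)
  linarith

/-! ### No point of the unit sphere of `Y` is a relative Daugavet-point of `X` -/

/-- Equality in the triangle inequality would hold pointwise almost everywhere and force x ≤ 0 on S.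
-/
theorem norm_sub_normInd_lt {S : Set ℝ} (hS : MeasurableSet S) (h0 : volI.real S ≠ 0) {x : L1I}
    (hx : 0 < setInt S x) : ‖x - normInd S hS‖ < ‖x‖ + 1 := by
  by_contra! hle
  have hn := norm_normInd hS h0
  have hi := fun z : L1I => L1.integrable_coeFn z
  have hadd : Integrable (fun a => |x a| + |normInd S hS a|) volI :=
    (hi x).abs.add (hi (normInd S hS)).abs
  have hint : Integrable (fun a => |x a| + |normInd S hS a| - |(x - normInd S hS : L1I) a|) volI :=
    hadd.sub (hi (x - normInd S hS)).abs
  have hsub := Lp.coeFn_sub x (normInd S hS)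
  have hnn : 0 ≤ᵐ[volI] fun a => |x a| + |normInd S hS a| - |(x - normInd S hS : L1I) a| := by
    filter_upwards [hsub] with a ha
    rw [ha, Pi.sub_apply, Pi.zero_apply, sub_nonneg]
    exact abs_sub _ _
  have hzero : ∫ a, (|x a| + |normInd S hS a| - |(x - normInd S hS : L1I) a|) ∂volI = 0 := by
    refine le_antisymm ?_ (integral_nonneg_of_ae hnn)
    rw [integral_sub hadd (hi (x - normInd S hS)).abs,
      integral_add (hi x).abs (hi (normInd S hS)).abs]
    simp only [L1.norm_eq_integral_norm, Real.norm_eq_abs] at hle hn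
    linarith
  have hae := (integral_eq_zero_iff_of_nonneg_ae hnn hint).1 hzero
  have hpos : 0 < (volI.real S)⁻¹ := inv_pos.2 (measureReal_nonneg.lt_of_ne' h0)
  have hnonpos : ∀ᵐ a ∂volI.restrict S, x a ≤ 0 := by
    rw [ae_restrict_iff' hS]
    filter_upwards [hae, hsub, coeFn_normInd S hS] with a h1 h2 h3 haS
    rw [h2, Pi.sub_apply, h3, indicator_of_mem haS, Pi.one_apply, mul_one, Pi.zero_apply] at h1
    by_contra! hxa
    rw [abs_of_pos hxa, abs_of_pos hpos] at h1
    rcases abs_cases (x a - (volI.real S)⁻¹) with ⟨h, -⟩ | ⟨h, -⟩ <;> linarith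
  have : setInt S x ≤ 0 := integral_nonpos_of_ae hnonpos
  linarith

theorem not_isRelativeDaugavetPoint_of_mem_spaceY {x : spaceX} (hxY : (x : L1I) ∈ spaceY) :
    ¬ IsRelativeDaugavetPoint x := by
  rintro ⟨hx, φ, α, hφ, hφx, hα, hD⟩
  have hφle : ∀ z, |φ z| ≤ ‖z‖ := fun z => by
    have := φ.le_opNorm z
    rwa [hφ, one_mul] at this
  have hxn : ‖(x : L1I)‖ = 1 := by rw [← Submodule.coe_norm, hx]
  -- The truncation keeps 1 - α' non-negative, as needed to multiply the bound on the sum of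
  -- coefficients.
  set α' := min α 1
  have hα' : 0 < α' := lt_min hα one_pos
  have hα'1 : α' ≤ 1 := min_le_right _ _
  obtain ⟨k, hk⟩ := Metric.tendsto_atTop.1 (tendsto_projF (y := x) hxY) α' hα'
  have hk := hk k le_rfl
  have hk1 : 1 ≤ k + 1 := Nat.le_add_left 1 k
  set n := k + 1
  have hne : ∀ s ∈ level n, s ≠ [] := fun s hs => by
    rintro rfl
    have := mem_level.1 hs
    simp [n] at this
  set p : spaceX := ∑ s ∈ (level n).attach, setInt (setF n s) (x : L1I) • fX s (hne s s.2)
  have hp : (p : L1I) = projF n x := by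
    rw [projF_apply, ← Finset.sum_attach, Submodule.coe_sum]
    rfl
  have hφp : 1 - α' < φ p := by
    have h1 : ‖p - x‖ < α' := by
      rw [Submodule.coe_norm, Submodule.coe_sub, hp, ← dist_eq_norm]
      exact hk
    have h2 := hφle (p - x)
    rw [map_sub, hφx] at h2
    have := (abs_le.1 h2).1
    linarith
  -- Otherwise summing over s would give φ(p) ≤ 1 - α', as the coefficients have absolute sum at
  -- most ‖x‖ = 1. Strictness also makes the chosen coefficient non-zero.
  obtain ⟨s, hs, hlt⟩ : ∃ s, ∃ hs : s ∈ level n, (1 - α') * |setInt (setF n s) (x : L1I)| <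
      setInt (setF n s) (x : L1I) * φ (fX s (hne s hs)) := by
    by_contra! hcon
    have h1 : φ p ≤ ∑ s ∈ (level n).attach, (1 - α') * |setInt (setF n s) (x : L1I)| := by
      rw [map_sum]
      refine Finset.sum_le_sum fun s _ => ?_
      rw [map_smul, smul_eq_mul]
      exact hcon s s.2
    rw [Finset.sum_attach _ (fun s => (1 - α') * |setInt (setF n s) (x : L1I)|),
      ← Finset.mul_sum] at h1
    have h2 := mul_le_mul_of_nonneg_left (sum_abs_setInt_setF_le hk1 (x : L1I))
      (sub_nonneg.2 hα'1)
    rw [hxn, mul_one] at h2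
    linarith
  have hsne := hne s hs
  have hsn : s.length = n := mem_level.1 hs
  set a := setInt (setF n s) (x : L1I)
  have ha : a ≠ 0 := by
    intro h
    rw [h, abs_zero, mul_zero, zero_mul] at hlt
    exact lt_irrefl _ hlt
  obtain ⟨σ, hσ, hσa⟩ : ∃ σ : ℝ, |σ| = 1 ∧ σ * a = |a| := by
    rcases abs_cases a with ⟨h, -⟩ | ⟨h, -⟩
    · exact ⟨1, by simp, by rw [h, one_mul]⟩
    · exact ⟨-1, by simp, by rw [h]; ring⟩
  have hσσ : σ * σ = 1 := by rw [← abs_mul_abs_self, hσ, one_mul]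
  have hφσ : 1 - α < φ (σ • fX s hsne) := by
    have hpos : 0 < |a| := abs_pos.2 ha
    have e : a = σ * |a| := by rw [← hσa, ← mul_assoc, hσσ, one_mul]
    have h1 : (1 - α') * |a| < (σ * φ (fX s hsne)) * |a| := by
      calc (1 - α') * |a| < a * φ (fX s hsne) := hlt
        _ = (σ * φ (fX s hsne)) * |a| := by rw [e]; simp only [abs_mul, abs_abs, hσ]; ring
    have h2 := lt_of_mul_lt_mul_right h1 hpos.le
    rw [map_smul, smul_eq_mul]
    linarith [min_le_left α 1]
  have hdist : ‖x - σ • fX s hsne‖ < 2 := by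
    have e : x - σ • fX s hsne = σ • (σ • x - fX s hsne) := by
      rw [smul_sub, smul_smul, hσσ, one_smul]
    rw [e, norm_smul, Real.norm_eq_abs, hσ, one_mul]
    have h1 := norm_sub_normInd_lt ((isSetTree_setF hk1).measurableSet s)
      ((isSetTree_setF hk1).real_pos s).ne' (x := σ • (x : L1I)) (by
        rw [map_smul, smul_eq_mul, hσa]
        exact abs_pos.2 ha)
    rw [← f_eq_of_mem_level hk1 hs, norm_smul, Real.norm_eq_abs, hσ, hxn] at h1
    rw [Submodule.coe_norm]
    refine lt_of_lt_of_eq h1 (by norm_num)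
  set D := ‖x - σ • fX s hsne‖
  -- The first radius keeps the slice at distance below 2 from x, the second keeps it inside `slice
  -- φ α`.
  obtain ⟨β, hβ, hsl⟩ := exists_slice_subset hsne hσ
    (δ := min ((2 - D) / 2) ((φ (σ • fX s hsne) - (1 - α)) / 2))
    (lt_min (by linarith) (by linarith))
  have hsub : slice (σ • exposing s) β ⊆ slice φ α := by
    intro z hz
    refine ⟨hz.1, ?_⟩
    have h1 := (hsl z hz).trans (min_le_right _ _)
    have h2 := (abs_le.1 (hφle (z - σ • fX s hsne))).1
    rw [map_sub] at h2
    linarith [sSup_image_closedBall_le hφle]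
  have h := (hD _ β hβ hsub).2 (show 2 - (2 - D) / 2 ∈ _ by
    rintro _ ⟨z, hz, rfl⟩
    have h1 := (hsl z hz).trans (min_le_left _ _)
    have h2 : ‖x - z‖ ≤ D + ‖z - σ • fX s hsne‖ := by
      have e : x - z = (x - σ • fX s hsne) - (z - σ • fX s hsne) := by abel
      rw [e]
      exact norm_sub_le _ _
    show ‖x - z‖ ≤ _
    linarith)
  linarith

end

end DaugavetL1

theorem mainTheorem12 :
    ¬ DaugavetL1.IsReflexiveSpace DaugavetL1.spaceX ∧
    ¬ DaugavetL1.HasDLD2P DaugavetL1.spaceX ∧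
    Nonempty (DaugavetL1.spaceY ≃ₗᵢ[ℝ] DaugavetL1.L1I) ∧
    ∃ hYX : DaugavetL1.spaceY ≤ DaugavetL1.spaceX,
      ∀ y : DaugavetL1.spaceY, ‖y‖ = 1 →
        DaugavetL1.IsDeltaPoint y ∧
        DaugavetL1.IsSuperDeltaPoint y ∧
        DaugavetL1.IsDeltaPoint (Submodule.inclusion hYX y) ∧
        DaugavetL1.IsSuperDeltaPoint (Submodule.inclusion hYX y) ∧
        ¬ DaugavetL1.IsRelativeDaugavetPoint (Submodule.inclusion hYX y) :=
  ⟨DaugavetL1.not_isReflexiveSpace_spaceX, DaugavetL1.not_hasDLD2P_spaceX,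
    DaugavetL1.nonempty_spaceY_equiv, DaugavetL1.spaceY_le_spaceX, fun y hy =>
      ⟨(DaugavetL1.isSuperDeltaPoint_spaceY hy).isDeltaPoint,
        DaugavetL1.isSuperDeltaPoint_spaceY hy,
        (DaugavetL1.isSuperDeltaPoint_inclusion hy).isDeltaPoint,
        DaugavetL1.isSuperDeltaPoint_inclusion hy,
        DaugavetL1.not_isRelativeDaugavetPoint_of_mem_spaceY (by
          rw [Submodule.coe_inclusion]; exact y.2)⟩⟩
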